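/- **Theorem ($\mathsf{QBox}$ is a post-quantum theory).** *Conventions.* A process theory is a symmetric monoidal category. Quantum systems are nonzero finite-dimensional Hilbert spaces with a chosen orthonormal basis, $H=\mathbb{C}^X$ with $X$ a finite nonempty set. $\mathsf{CP}$ has these as systems and the completely positive maps $B(H)\to B(K)$ as processes, with the usual tensor product. $\mathsf{CPTP}$ is its sub-theory of trace-preserving maps. $D(\mathsf{CP})$ has as systems the formal tensor products $A=\bigotimes_{i=1}^n[H_i,H_i]$, $n\ge 1$. A process $\bigotimes_i[H_i,H_i]\to\bigotimes_j[K_j,K_j]$ is a process $\bigotimes_i(H_i\otimes H_i)\to\bigotimes_j(K_j\otimes K_j)$ of $\mathsf{CP}$; in each pair the first factor is the input (bottom) and the second the output (top). Composition and tensor product are those of $\mathsf{CP}$, and the trivial system is $I=[\mathbb{C},\mathbb{C}]$. Let $\Sigma_A$ be the set of process matrices on $A$, i.e. the positive functionals $W$ on the operators of $\bigotimes_i(H_i\otimes H_i)$ with $W(C_{f_1}\otimes\dots\otimes C_{f_n})=1$ for all channels $f_i:H_i\to H_i$, where $C_f=\sum_{a,b}|a\rangle\langle b|\otimes f(|a\rangle\langle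 b|)$. A process $S:A\to B$ is *deterministic* if $W\circ(S\otimes 1_L)\in\Sigma_{A\otimes L}$ for every system $L$ and every $W\in\Sigma_{B\otimes L}$. The process theory $\mathsf{QBox}$ consists of all systems and the deterministic processes of $D(\mathsf{CP})$. A state of a theory on a system is a process from the trivial system to it. A state of $\mathsf{QBox}$ (of $\mathsf{CPTP}$) is *pure* if it is not a convex combination of other states of that theory on the same system. It is *maximally mixed* if every state of that theory on the system occurs with positive weight in some convex decomposition of it and it is invariant under all invertible processes of that theory from the system to itself. Let $\mathtt{hypdec}_A:A\to A$ be the completely depolarising map $\rho\mapsto\operatorname{tr}(\rho)\,1/\dim H_i$ on every input factor and the identity on every output factor. *Statement.* Each $\mathtt{hypdec}_A$ is a process of $\mathsf{QBox}$, with $\mathtt{hypdec}_{A\otimes B}=\mathtt{hypdec}_A\otimes\mathtt{hypdec}_B$ and $\mathtt{hypdec}_I=1_I$, and: 1. (Ax1) $\mathtt{hypdec}_A\circ\mathtt{hypdec}_A=\mathtt{hypdec}_A$. 2. (Ax2) $\mathtt{hypdec}_A$ is no-backwards-signalling: there is $W_0\in\Sigma_A$ such that $W\circ\mathtt{hypdec}_A=W_0$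 for all $W\in\Sigma_A$. 3. There is a symmetric strong monoidal, full, faithful and essentially surjective functor $F$ to $\mathsf{CPTP}$ from the full sub-process theory, spanned by the systems $(A,\mathtt{hypdec}_A)$, of the idempotent splitting of $\mathsf{QBox}$, and $F$ preserves convex combinations of processes. (In the idempotent splitting, systems are pairs $(A,e)$ with $e$ an idempotent on $A$, processes $(A,e)\to(B,e')$ are the $S:A\to B$ with $S=e'Se$, and the identity of $(A,e)$ is $e$.) 4. (Ax3) For every state $s$ of $\mathsf{QBox}$ on $A$, if the state of $\mathsf{CPTP}$ corresponding under $F$ to $\mathtt{hypdec}_A\circ s$ is pure, then $s$ is pure. 5. (Ax4) Every system $A$ of $\mathsf{QBox}$ has a maximally mixed state, and if $s$ is a maximally mixed state on $A$, then the state of $\mathsf{CPTP}$ corresponding under $F$ to $\mathtt{hypdec}_A\circ s$ is maximally mixed. Moreover, $\mathtt{hypdec}_A\neq 1_A$ for some $A$. Hence $\mathsf{QBox}$ supports hyper-decoherence to $\mathsf{CPTP}$ by a map that is not always the identity, i.e. $\mathsf{QBox}$ is post-quantum. -/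

import Mathlib

open CategoryTheory MonoidalCategory
open scoped NNReal ComplexOrder Kronecker

/-! ### Idempotent splitting of a process theory -/

namespace CategoryTheory.Idempotents.Karoubi

variable {C : Type*} [Category* C] [MonoidalCategory C]

/-- The tensor product of the splittings `(X, e)` and `(Y, e')` is `(X ⊗ Y, e ⊗ e')`, and the unit
is `(I, 1)`. All structure maps are those of `C`, made invariant under the idempotents. -/
@[simps tensorObj_X tensorObj_p tensorUnit_X tensorUnit_p tensorHom_f whiskerLeft_f whiskerRight_f
  associator_hom_f associator_inv_f leftUnitor_hom_f leftUnitor_inv_f rightUnitor_hom_f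
  rightUnitor_inv_f]
instance monoidalStruct : MonoidalCategoryStruct (Karoubi C) where
  tensorObj P Q := ⟨P.X ⊗ Q.X, P.p ⊗ₘ Q.p, by simp only [tensorHom_comp_tensorHom, idem]⟩
  tensorUnit := ⟨𝟙_ C, 𝟙 _, Category.id_comp _⟩
  tensorHom f g := ⟨f.f ⊗ₘ g.f, by simp only [tensorHom_comp_tensorHom, p_comp, comp_p]⟩
  whiskerLeft P _ _ g := ⟨P.p ⊗ₘ g.f, by
    simp only [tensorHom_comp_tensorHom, p_comp, comp_p, idem]⟩
  whiskerRight f Q := ⟨f.f ⊗ₘ Q.p, by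
    simp only [tensorHom_comp_tensorHom, p_comp, comp_p, idem]⟩
  associator P Q R :=
    { hom := ⟨((P.p ⊗ₘ Q.p) ⊗ₘ R.p) ≫ (α_ P.X Q.X R.X).hom, by
        simp only [Category.assoc, ← associator_naturality, tensorHom_comp_tensorHom_assoc,
          tensorHom_comp_tensorHom, idem]⟩
      inv := ⟨(P.p ⊗ₘ (Q.p ⊗ₘ R.p)) ≫ (α_ P.X Q.X R.X).inv, by
        simp only [Category.assoc, ← associator_inv_naturality, tensorHom_comp_tensorHom_assoc,
          tensorHom_comp_tensorHom, idem]⟩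
      hom_inv_id := by
        ext
        simp only [comp_f, id_f, Category.assoc, associator_inv_naturality, Iso.hom_inv_id_assoc,
          tensorHom_comp_tensorHom, idem]
      inv_hom_id := by
        ext
        simp only [comp_f, id_f, Category.assoc, associator_naturality, Iso.inv_hom_id_assoc,
          tensorHom_comp_tensorHom, idem] }
  leftUnitor P :=
    { hom := ⟨(𝟙 _ ⊗ₘ P.p) ≫ (λ_ P.X).hom, by
        simp only [id_tensorHom, Category.assoc, ← leftUnitor_naturality,
          ← whiskerLeft_comp_assoc, idem]⟩
      inv := ⟨P.p ≫ (λ_ P.X).inv, by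
        simp only [id_tensorHom, Category.assoc, ← leftUnitor_inv_naturality, idem_assoc]⟩
      hom_inv_id := by
        ext
        simp only [comp_f, id_f, id_tensorHom, Category.assoc, leftUnitor_inv_naturality,
          Iso.hom_inv_id_assoc, ← whiskerLeft_comp, idem]
      inv_hom_id := by
        ext
        simp only [comp_f, id_f, id_tensorHom, Category.assoc, leftUnitor_naturality,
          Iso.inv_hom_id_assoc, idem] }
  rightUnitor P :=
    { hom := ⟨(P.p ⊗ₘ 𝟙 _) ≫ (ρ_ P.X).hom, by
        simp only [tensorHom_id, Category.assoc, ← rightUnitor_naturality,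
          ← comp_whiskerRight_assoc, idem]⟩
      inv := ⟨P.p ≫ (ρ_ P.X).inv, by
        simp only [tensorHom_id, Category.assoc, ← rightUnitor_inv_naturality, idem_assoc]⟩
      hom_inv_id := by
        ext
        simp only [comp_f, id_f, tensorHom_id, Category.assoc, rightUnitor_inv_naturality,
          Iso.hom_inv_id_assoc, ← comp_whiskerRight, idem]
      inv_hom_id := by
        ext
        simp only [comp_f, id_f, tensorHom_id, Category.assoc, rightUnitor_naturality,
          Iso.inv_hom_id_assoc, idem] }

theorem tensorHom_comp_right {X Y Z X' Y' : C} (f : X ⟶ Y) (g : Y ⟶ Z) (h : X' ⟶ Y') :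
    (f ≫ g) ⊗ₘ h = (f ⊗ₘ h) ≫ g ▷ Y' := by
  rw [← tensorHom_id, tensorHom_comp_tensorHom, Category.comp_id]

theorem tensorHom_comp_left {X Y Z X' Y' : C} (f : X ⟶ Y) (g : Y ⟶ Z) (h : X' ⟶ Y') :
    h ⊗ₘ (f ≫ g) = (h ⊗ₘ f) ≫ Y' ◁ g := by
  rw [← id_tensorHom, tensorHom_comp_tensorHom, Category.comp_id]

instance monoidal : MonoidalCategory (Karoubi C) :=
  MonoidalCategory.ofTensorHom
    (id_tensorHom_id := fun P Q => by ext; rfl)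
    (id_tensorHom := fun P Q R f => by ext; rfl)
    (tensorHom_id := fun f P => by ext; rfl)
    (tensorHom_comp_tensorHom := fun f₁ f₂ g₁ g₂ => by
      ext
      simp only [comp_f, monoidalStruct_tensorHom_f, tensorHom_comp_tensorHom])
    (associator_naturality := fun f₁ f₂ f₃ => by
      ext
      simp only [comp_f, monoidalStruct_tensorHom_f, monoidalStruct_associator_hom_f,
        tensorHom_comp_tensorHom_assoc, tensorHom_comp_tensorHom, comp_p, Category.assoc,
        ← associator_naturality, p_comp])
    (leftUnitor_naturality := fun f => by
      ext
      simp only [comp_f, monoidalStruct_tensorHom_f, monoidalStruct_leftUnitor_hom_f, id_f,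
        monoidalStruct_tensorUnit_p, id_tensorHom, Category.assoc, ← leftUnitor_naturality,
        ← whiskerLeft_comp_assoc, comp_p, p_comp, monoidalStruct_tensorUnit_X])
    (rightUnitor_naturality := fun f => by
      ext
      simp only [comp_f, monoidalStruct_tensorHom_f, monoidalStruct_rightUnitor_hom_f, id_f,
        monoidalStruct_tensorUnit_p, tensorHom_id, Category.assoc, ← rightUnitor_naturality,
        ← comp_whiskerRight_assoc, comp_p, p_comp, monoidalStruct_tensorUnit_X])
    (pentagon := fun P Q R S => by
      ext
      simp only [comp_f, monoidalStruct_tensorHom_f, monoidalStruct_associator_hom_f, id_f,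
        monoidalStruct_tensorObj_X, monoidalStruct_tensorObj_p, tensorHom_comp_right,
        tensorHom_comp_left, Category.assoc]
      have h₁ := associator_naturality P.p (Q.p ⊗ₘ R.p) S.p
      have h₂ := associator_naturality (P.p ⊗ₘ Q.p) R.p S.p
      have h₃ : (α_ P.X Q.X R.X).hom ▷ S.X ≫ ((P.p ⊗ₘ (Q.p ⊗ₘ R.p)) ⊗ₘ S.p) =
          (((P.p ⊗ₘ Q.p) ⊗ₘ R.p) ⊗ₘ S.p) ≫ (α_ P.X Q.X R.X).hom ▷ S.X := by
        rw [← tensorHom_id, tensorHom_comp_tensorHom, tensorHom_comp_tensorHom,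
          ← associator_naturality, Category.id_comp, Category.comp_id]
      rw [← reassoc_of% h₁, reassoc_of% h₃, ← reassoc_of% h₂, reassoc_of% h₃]
      simp only [tensorHom_comp_tensorHom_assoc, tensorHom_comp_tensorHom, idem, pentagon])
    (triangle := fun P Q => by
      ext
      simp only [comp_f, monoidalStruct_tensorHom_f, monoidalStruct_associator_hom_f, id_f,
        monoidalStruct_tensorObj_X, tensorHom_comp_right,
        tensorHom_comp_left, Category.assoc, monoidalStruct_leftUnitor_hom_f,
        monoidalStruct_rightUnitor_hom_f, monoidalStruct_tensorUnit_X,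
        monoidalStruct_tensorUnit_p]
      have h₁ := associator_naturality P.p (𝟙 (𝟙_ C)) Q.p
      rw [← reassoc_of% h₁]
      simp only [tensorHom_comp_tensorHom_assoc, tensorHom_comp_tensorHom, idem, triangle,
        Category.comp_id])

instance braided [BraidedCategory C] : BraidedCategory (Karoubi C) where
  braiding P Q :=
    { hom := ⟨(P.p ⊗ₘ Q.p) ≫ (β_ P.X Q.X).hom, by
        simp only [monoidalStruct_tensorObj_p, Category.assoc, ← BraidedCategory.braiding_naturality,
          tensorHom_comp_tensorHom_assoc, idem]⟩
      inv := ⟨(Q.p ⊗ₘ P.p) ≫ (β_ P.X Q.X).inv, by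
        simp only [monoidalStruct_tensorObj_p, Category.assoc,
          ← BraidedCategory.braiding_inv_naturality,
          tensorHom_comp_tensorHom_assoc, idem]⟩
      hom_inv_id := by
        ext
        simp only [comp_f, id_f, Category.assoc, BraidedCategory.braiding_inv_naturality,
          Iso.hom_inv_id_assoc, tensorHom_comp_tensorHom, idem, monoidalStruct_tensorObj_p]
      inv_hom_id := by
        ext
        simp only [comp_f, id_f, Category.assoc, BraidedCategory.braiding_naturality,
          Iso.inv_hom_id_assoc, tensorHom_comp_tensorHom, idem, monoidalStruct_tensorObj_p] }
  braiding_naturality_left f Z := by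
    ext
    change (f.f ⊗ₘ Z.p) ≫ (_ ⊗ₘ _) ≫ _ = ((_ ⊗ₘ _) ≫ _) ≫ (Z.p ⊗ₘ f.f)
    simp only [Category.assoc, ← BraidedCategory.braiding_naturality,
      tensorHom_comp_tensorHom_assoc, idem, comp_p, p_comp]
  braiding_naturality_right Z _ _ f := by
    ext
    change (Z.p ⊗ₘ f.f) ≫ (_ ⊗ₘ _) ≫ _ = ((_ ⊗ₘ _) ≫ _) ≫ (f.f ⊗ₘ Z.p)
    simp only [Category.assoc, ← BraidedCategory.braiding_naturality,
      tensorHom_comp_tensorHom_assoc, idem, comp_p, p_comp]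
  hexagon_forward P Q R := by
    ext
    change (((P.p ⊗ₘ Q.p) ⊗ₘ R.p) ≫ (α_ _ _ _).hom) ≫ ((P.p ⊗ₘ (Q.p ⊗ₘ R.p)) ≫ (β_ _ _).hom) ≫
        ((Q.p ⊗ₘ R.p) ⊗ₘ P.p) ≫ (α_ _ _ _).hom =
      (((P.p ⊗ₘ Q.p) ≫ (β_ _ _).hom) ⊗ₘ R.p) ≫ (((Q.p ⊗ₘ P.p) ⊗ₘ R.p) ≫ (α_ _ _ _).hom) ≫
        (Q.p ⊗ₘ ((P.p ⊗ₘ R.p) ≫ (β_ _ _).hom))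
    have h₁ : (β_ P.X Q.X).hom ▷ R.X ≫ ((Q.p ⊗ₘ P.p) ⊗ₘ R.p) =
        ((P.p ⊗ₘ Q.p) ⊗ₘ R.p) ≫ (β_ P.X Q.X).hom ▷ R.X := by
      rw [← tensorHom_id, tensorHom_comp_tensorHom, tensorHom_comp_tensorHom,
        ← BraidedCategory.braiding_naturality, Category.id_comp, Category.comp_id]
    have h₂ := BraidedCategory.braiding_naturality P.p (Q.p ⊗ₘ R.p)
    have h₃ := associator_naturality P.p Q.p R.p
    have h₄ := associator_naturality Q.p P.p R.p
    simp only [tensorHom_comp_right, tensorHom_comp_left, Category.assoc]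
    rw [← reassoc_of% h₂, ← reassoc_of% h₃, ← reassoc_of% h₃, ← reassoc_of% h₄, reassoc_of% h₁,
      reassoc_of% h₁]
    simp only [tensorHom_comp_tensorHom_assoc, tensorHom_comp_tensorHom, idem,
      BraidedCategory.hexagon_forward]
  hexagon_reverse P Q R := by
    ext
    change ((P.p ⊗ₘ (Q.p ⊗ₘ R.p)) ≫ (α_ _ _ _).inv) ≫ (((P.p ⊗ₘ Q.p) ⊗ₘ R.p) ≫ (β_ _ _).hom) ≫
        (R.p ⊗ₘ (P.p ⊗ₘ Q.p)) ≫ (α_ _ _ _).inv =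
      (P.p ⊗ₘ ((Q.p ⊗ₘ R.p) ≫ (β_ _ _).hom)) ≫ ((P.p ⊗ₘ (R.p ⊗ₘ Q.p)) ≫ (α_ _ _ _).inv) ≫
        (((P.p ⊗ₘ R.p) ≫ (β_ _ _).hom) ⊗ₘ Q.p)
    have h₁ : P.X ◁ (β_ Q.X R.X).hom ≫ (P.p ⊗ₘ (R.p ⊗ₘ Q.p)) =
        (P.p ⊗ₘ (Q.p ⊗ₘ R.p)) ≫ P.X ◁ (β_ Q.X R.X).hom := by
      rw [← id_tensorHom, tensorHom_comp_tensorHom, tensorHom_comp_tensorHom,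
        ← BraidedCategory.braiding_naturality, Category.id_comp, Category.comp_id]
    have h₂ := BraidedCategory.braiding_naturality (P.p ⊗ₘ Q.p) R.p
    have h₃ := associator_inv_naturality P.p Q.p R.p
    have h₄ := associator_inv_naturality P.p R.p Q.p
    simp only [tensorHom_comp_right, tensorHom_comp_left, Category.assoc]
    rw [← reassoc_of% h₂, ← reassoc_of% h₃, ← reassoc_of% h₃, ← reassoc_of% h₄, reassoc_of% h₁,
      reassoc_of% h₁]
    simp only [tensorHom_comp_tensorHom_assoc, tensorHom_comp_tensorHom, idem,
      BraidedCategory.hexagon_reverse]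

instance symmetric [SymmetricCategory C] : SymmetricCategory (Karoubi C) where
  symmetry P Q := by
    ext
    change ((P.p ⊗ₘ Q.p) ≫ (β_ _ _).hom) ≫ ((Q.p ⊗ₘ P.p) ≫ (β_ _ _).hom) = P.p ⊗ₘ Q.p
    have h := BraidedCategory.braiding_naturality P.p Q.p
    rw [Category.assoc, ← reassoc_of% h, SymmetricCategory.symmetry, Category.comp_id,
      tensorHom_comp_tensorHom, idem, idem]

end CategoryTheory.Idempotents.Karoubi

namespace QuantumBox

/-! ### Mixed quantum theory -/

/-- A finite-dimensional nonzero Hilbert space with a chosen orthonormal basis, i.e. `ℂ^ι`. -/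
structure QSystem : Type 1 where
  /-- the set labelling the orthonormal basis -/
  ι : Type
  [fintype : Fintype ι]
  [decEq : DecidableEq ι]
  [nonempty : Nonempty ι]

attribute [instance] QSystem.fintype QSystem.decEq QSystem.nonempty

/-- The operators on the Hilbert space `ℂ^ι`. -/
abbrev Op (X : QSystem) : Type := Matrix X.ι X.ι ℂ

section Maps

variable {n m k l : Type}

/-- The linear map `f ⊗ id` on operators of `ℂ^n ⊗ ℂ^k`. -/
def tensorRight (f : Matrix n n ℂ →ₗ[ℂ] Matrix m m ℂ) (k : Type) :
    Matrix (n × k) (n × k) ℂ →ₗ[ℂ] Matrix (m × k) (m × k) ℂ where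
  toFun M := Matrix.of fun p q => f (Matrix.of fun i j => M (i, p.2) (j, q.2)) p.1 q.1
  map_add' M N := by
    ext p q
    exact congrFun (congrFun (f.map_add (Matrix.of fun i j => M (i, p.2) (j, q.2))
      (Matrix.of fun i j => N (i, p.2) (j, q.2))) p.1) q.1
  map_smul' c M := by
    ext p q
    exact congrFun (congrFun (f.map_smul c (Matrix.of fun i j => M (i, p.2) (j, q.2))) p.1) q.1

/-- Relabelling of the basis. -/
def relabel (e : n ≃ m) : Matrix n n ℂ →ₗ[ℂ] Matrix m m ℂ where
  toFun M := M.submatrix e.symm e.symm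
  map_add' _ _ := rfl
  map_smul' _ _ := rfl

/-- The linear map `id ⊗ f` on operators of `ℂ^k ⊗ ℂ^n`. -/
def tensorLeft (k : Type) (f : Matrix n n ℂ →ₗ[ℂ] Matrix m m ℂ) :
    Matrix (k × n) (k × n) ℂ →ₗ[ℂ] Matrix (k × m) (k × m) ℂ :=
  relabel (Equiv.prodComm m k) ∘ₗ tensorRight f k ∘ₗ relabel (Equiv.prodComm k n)

/-- Complete positivity: `f ⊗ id` is positive for every finite-dimensional ancilla `ℂ^k`. -/
def IsCompletelyPositive (f : Matrix n n ℂ →ₗ[ℂ] Matrix m m ℂ) : Prop :=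
  ∀ (k : Type) [Finite k] (M : Matrix (n × k) (n × k) ℂ), M.PosSemidef →
    (tensorRight f k M).PosSemidef

theorem IsCompletelyPositive.comp {g : Matrix m m ℂ →ₗ[ℂ] Matrix l l ℂ}
    {f : Matrix n n ℂ →ₗ[ℂ] Matrix m m ℂ} (hg : IsCompletelyPositive g)
    (hf : IsCompletelyPositive f) : IsCompletelyPositive (g ∘ₗ f) :=
  fun k _ _ hM => hg k _ (hf k _ hM)

theorem isCompletelyPositive_relabel (e : n ≃ m) : IsCompletelyPositive (relabel e) :=
  fun k _ _ hM => hM.submatrix (fun p : m × k => (e.symm p.1, p.2))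

theorem IsCompletelyPositive.tensorRight {f : Matrix n n ℂ →ₗ[ℂ] Matrix m m ℂ}
    (hf : IsCompletelyPositive f) (k : Type) [Finite k] :
    IsCompletelyPositive (tensorRight f k) :=
  fun l _ M hM => (hf (k × l) (M.submatrix (Equiv.prodAssoc n k l).symm
    (Equiv.prodAssoc n k l).symm) (hM.submatrix _)).submatrix (Equiv.prodAssoc m k l)

theorem IsCompletelyPositive.tensorLeft {f : Matrix n n ℂ →ₗ[ℂ] Matrix m m ℂ}
    (hf : IsCompletelyPositive f) (k : Type) [Finite k] :
    IsCompletelyPositive (tensorLeft k f) :=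
  (isCompletelyPositive_relabel _).comp
    ((hf.tensorRight k).comp (isCompletelyPositive_relabel _))

variable (n m) in
/-- The convex cone of completely positive maps. -/
def cpCone : Submodule ℝ≥0 (Matrix n n ℂ →ₗ[ℂ] Matrix m m ℂ) where
  carrier := {f | IsCompletelyPositive f}
  zero_mem' := fun _ _ _ _ => Matrix.PosSemidef.zero
  add_mem' := fun hf hg k _ _ hM => (hf k _ hM).add (hg k _ hM)
  smul_mem' := fun c _ hf k _ _ hM =>
     (hf k _ hM).smul (zero_le : 0 ≤ c)

/-- The completely depolarising map `ρ ↦ tr(ρ) 1/d`. -/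
noncomputable def depolarise (n : Type) [Fintype n] [DecidableEq n] :
    Matrix n n ℂ →ₗ[ℂ] Matrix n n ℂ where
  toFun ρ := (ρ.trace / Fintype.card n) • (1 : Matrix n n ℂ)
  map_add' ρ σ := by rw [Matrix.trace_add, add_div, add_smul]
  map_smul' c ρ := by simp [mul_div_assoc, mul_smul]

theorem isCompletelyPositive_depolarise (n : Type) [Fintype n] [DecidableEq n] :
    IsCompletelyPositive (depolarise n) := by
  intro k _ M hM
  have := Fintype.ofFinite k
  classical
  have h₁ : (∑ i : n, M.submatrix (fun a : k => (i, a)) fun a : k => (i, a)).PosSemidef :=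
    Matrix.posSemidef_sum _ fun i _ => hM.submatrix _
  have h₂ : ((Fintype.card n : ℝ≥0)⁻¹ • (1 : Matrix n n ℂ)).PosSemidef :=
    Matrix.PosSemidef.one.smul zero_le
  suffices h : tensorRight (depolarise n) k M = ((Fintype.card n : ℝ≥0)⁻¹ • (1 : Matrix n n ℂ)) ⊗ₖ
      (∑ i : n, M.submatrix (fun a : k => (i, a)) fun a : k => (i, a)) by
    rw [h]
    exact h₂.kronecker h₁
  ext p q
  simp [tensorRight, depolarise, Matrix.trace, Matrix.sum_apply, Matrix.kroneckerMap_apply,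
    Matrix.smul_apply, NNReal.smul_def]
  ring

/-- Expansion of a linear map between operator spaces in its matrix entries. -/
theorem apply_eq_sum [Fintype n] [DecidableEq n] (f : Matrix n n ℂ →ₗ[ℂ] Matrix m m ℂ)
    (M : Matrix n n ℂ) (a b : m) :
    f M a b = ∑ i, ∑ j, M i j * f (Matrix.single i j 1) a b := by
  conv_lhs => rw [Matrix.matrix_eq_sum_single M]
  simp only [map_sum, Matrix.sum_apply]
  refine Finset.sum_congr rfl fun i _ => Finset.sum_congr rfl fun j _ => ?_
  rw [← mul_one (M i j), ← smul_eq_mul, ← Matrix.smul_single, map_smul]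
  simp

theorem tensor_exchange [Fintype n] [DecidableEq n] [Fintype k] [DecidableEq k]
    (f : Matrix n n ℂ →ₗ[ℂ] Matrix m m ℂ) (g : Matrix k k ℂ →ₗ[ℂ] Matrix l l ℂ)
    (M : Matrix (n × k) (n × k) ℂ) :
    tensorRight f l (tensorLeft n g M) = tensorLeft m g (tensorRight f k M) := by
  ext ⟨a, c⟩ ⟨b, d⟩
  change f (Matrix.of fun i j => g (Matrix.of fun x y => M (i, x) (j, y)) c d) a b =
    g (Matrix.of fun x y => f (Matrix.of fun i j => M (i, x) (j, y)) a b) c d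
  rw [apply_eq_sum f, apply_eq_sum g]
  simp only [Matrix.of_apply]
  simp_rw [apply_eq_sum f (Matrix.of fun i j => M (i, _) (j, _)),
    apply_eq_sum g (Matrix.of fun i j => M (_, i) (_, j)), Finset.sum_mul, Matrix.of_apply]
  simp_rw [← Finset.sum_product' (Finset.univ : Finset n) (Finset.univ : Finset n),
    ← Finset.sum_product' (Finset.univ : Finset k) (Finset.univ : Finset k)]
  rw [Finset.sum_comm]
  exact Finset.sum_congr rfl fun _ _ => Finset.sum_congr rfl fun _ _ => by ring

end Maps

/-- The category of completely positive maps. -/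
instance : Category QSystem where
  Hom X Y := cpCone X.ι Y.ι
  id X := ⟨LinearMap.id, fun _ _ _ hM => hM⟩
  comp f g := ⟨g.1 ∘ₗ f.1, g.2.comp f.2⟩

noncomputable instance (X Y : QSystem) : AddCommMonoid (X ⟶ Y) := inferInstanceAs (AddCommMonoid (cpCone X.ι Y.ι))

noncomputable instance (X Y : QSystem) : Module ℝ≥0 (X ⟶ Y) := inferInstanceAs (Module ℝ≥0 (cpCone X.ι Y.ι))

/-- The linear map underlying a completely positive map. -/
def toLin {X Y : QSystem} (f : X ⟶ Y) : Op X →ₗ[ℂ] Op Y := f.1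

theorem hom_ext {X Y : QSystem} {f g : X ⟶ Y} (h : ∀ M, toLin f M = toLin g M) : f = g :=
  Subtype.ext (LinearMap.ext h)

/-- The invertible process which relabels the basis. -/
def relabelIso {X Y : QSystem} (e : X.ι ≃ Y.ι) : X ≅ Y where
  hom := ⟨relabel e, isCompletelyPositive_relabel e⟩
  inv := ⟨relabel e.symm, isCompletelyPositive_relabel e.symm⟩
  hom_inv_id := hom_ext fun M => by
    ext a b
    change M (e.symm (e a)) (e.symm (e b)) = M a b
    simp
  inv_hom_id := hom_ext fun M => by
    ext a b
    change M (e (e.symm a)) (e (e.symm b)) = M a b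
    simp

instance : MonoidalCategoryStruct QSystem where
  tensorObj X Y := ⟨X.ι × Y.ι⟩
  tensorUnit := ⟨Unit⟩
  whiskerLeft X _ _ f := ⟨tensorLeft X.ι (toLin f), f.2.tensorLeft X.ι⟩
  whiskerRight f Y := ⟨tensorRight (toLin f) Y.ι, f.2.tensorRight Y.ι⟩
  tensorHom {_ Y₁ X₂ _} f g := ⟨tensorLeft Y₁.ι (toLin g) ∘ₗ tensorRight (toLin f) X₂.ι,
    (g.2.tensorLeft Y₁.ι).comp (f.2.tensorRight X₂.ι)⟩
  associator X Y Z := relabelIso (Equiv.prodAssoc X.ι Y.ι Z.ι)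
  leftUnitor X := relabelIso (Equiv.punitProd X.ι)
  rightUnitor X := relabelIso (Equiv.prodPUnit X.ι)

/-- Completely positive maps form a monoidal category for the usual tensor product. -/
instance : MonoidalCategory QSystem where
  tensorHom_def _ _ := rfl
  id_tensorHom_id _ _ := rfl
  tensorHom_comp_tensorHom _ f₂ g₁ g₂ := hom_ext fun _ =>
    congrArg (tensorLeft _ (toLin g₂)) (tensor_exchange (toLin g₁) (toLin f₂) _)
  whiskerLeft_id _ _ := rfl
  id_whiskerRight _ _ := rfl
  associator_naturality _ _ _ := rfl
  leftUnitor_naturality _ := rfl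
  rightUnitor_naturality _ := rfl
  pentagon _ _ _ _ := rfl
  triangle _ _ := rfl

/-- The swap of two systems. -/
instance : SymmetricCategory QSystem where
  braiding X Y := relabelIso (Equiv.prodComm X.ι Y.ι)
  braiding_naturality_left _ _ := rfl
  braiding_naturality_right _ _ _ _ := rfl
  hexagon_forward _ _ _ := rfl
  hexagon_reverse _ _ _ := rfl
  symmetry _ _ := rfl

/-- A map of operators preserves the trace. -/
def tracePreserving : MorphismProperty QSystem :=
  fun X _ f => ∀ M : Op X, (toLin f M).trace = M.trace

theorem trace_tensorRight {X Y : QSystem} {f : X ⟶ Y} (hf : tracePreserving f) (Z : QSystem) :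
    tracePreserving (f ▷ Z) := by
  intro M
  change ∑ p : Y.ι × Z.ι, toLin f (Matrix.of fun i j => M (i, p.2) (j, p.2)) p.1 p.1 =
    ∑ p : X.ι × Z.ι, M p p
  rw [Fintype.sum_prod_type_right, Fintype.sum_prod_type_right]
  exact Finset.sum_congr rfl fun z _ => hf (Matrix.of fun i j => M (i, z) (j, z))

theorem trace_relabel {X Y : QSystem} (e : X.ι ≃ Y.ι) :
    tracePreserving (relabelIso e).hom ∧ tracePreserving (relabelIso e).inv :=
  ⟨fun M => Equiv.sum_comp e.symm fun i => M i i, fun M => Equiv.sum_comp e fun i => M i i⟩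

instance : tracePreserving.IsMultiplicative where
  id_mem _ _ := rfl
  comp_mem _ _ hf hg M := (hg _).trans (hf M)

instance : tracePreserving.IsStableUnderBraiding where
  whiskerLeft X _ _ g hg := by
    have h : X ◁ g = (β_ _ _).hom ≫ g ▷ X ≫ (β_ _ _).hom := rfl
    rw [h]
    exact tracePreserving.comp_mem _ _ (trace_relabel _).1
      (tracePreserving.comp_mem _ _ (trace_tensorRight hg X) (trace_relabel _).1)
  whiskerRight f hf Y := trace_tensorRight hf Y
  associator_hom_mem _ _ _ := (trace_relabel _).1
  associator_inv_mem _ _ _ := (trace_relabel _).2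
  leftUnitor_hom_mem _ := (trace_relabel _).1
  leftUnitor_inv_mem _ := (trace_relabel _).2
  rightUnitor_hom_mem _ := (trace_relabel _).1
  rightUnitor_inv_mem _ := (trace_relabel _).2
  braiding_hom_mem _ _ := (trace_relabel _).1
  braiding_inv_mem _ _ := (trace_relabel _).2

/-- The process theory of completely positive trace-preserving maps. -/
abbrev CPTP : Type 1 := WideSubcategory tracePreserving

/-! ### Multi-environment structures and deterministic processes -/

section ProcessTheory

variable {C : Type*} [Category* C] [MonoidalCategory C] [SymmetricCategory C]

/-- The symmetries of a process theory: the processes which only permute (and rebracket) wires. -/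
inductive IsWirePermutation : ∀ {X Y : C}, (X ⟶ Y) → Prop
  | id (X : C) : IsWirePermutation (𝟙 X)
  | comp {X Y Z : C} {f : X ⟶ Y} {g : Y ⟶ Z} :
      IsWirePermutation f → IsWirePermutation g → IsWirePermutation (f ≫ g)
  | whiskerRight {X Y : C} {f : X ⟶ Y} (Z : C) : IsWirePermutation f → IsWirePermutation (f ▷ Z)
  | whiskerLeft {X Y : C} {f : X ⟶ Y} (Z : C) : IsWirePermutation f → IsWirePermutation (Z ◁ f)
  | associator_hom (X Y Z : C) : IsWirePermutation (α_ X Y Z).hom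
  | associator_inv (X Y Z : C) : IsWirePermutation (α_ X Y Z).inv
  | leftUnitor_hom (X : C) : IsWirePermutation (λ_ X).hom
  | leftUnitor_inv (X : C) : IsWirePermutation (λ_ X).inv
  | rightUnitor_hom (X : C) : IsWirePermutation (ρ_ X).hom
  | rightUnitor_inv (X : C) : IsWirePermutation (ρ_ X).inv
  | braiding (X Y : C) : IsWirePermutation (β_ X Y).hom

variable (C) in
/-- A multi-environment structure: families of discarding effects which are closed under the tensor
product, trivial on the trivial system and invariant under the symmetries. -/
structure MultiEnvironment where
  /-- the discarding effects of a system -/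
  effects : ∀ X : C, Set (X ⟶ 𝟙_ C)
  tensor_mem : ∀ {X Y : C} {d : X ⟶ 𝟙_ C} {e : Y ⟶ 𝟙_ C}, d ∈ effects X → e ∈ effects Y →
    (d ⊗ₘ e) ≫ (λ_ (𝟙_ C)).hom ∈ effects (X ⊗ Y)
  unit : effects (𝟙_ C) = {𝟙 _}
  symmetry_mem : ∀ {X Y : C} {σ : X ⟶ Y} {e : Y ⟶ 𝟙_ C}, IsWirePermutation σ → e ∈ effects Y →
    σ ≫ e ∈ effects X

/-- A process `f : X ⟶ Y` is deterministic if, applied to one part of any composite system, it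
pulls discarding effects back to discarding effects. -/
def MultiEnvironment.deterministic (E : MultiEnvironment C) : MorphismProperty C :=
  fun X Y f => ∀ (L : C) (e : Y ⊗ L ⟶ 𝟙_ C), e ∈ E.effects (Y ⊗ L) → f ▷ L ≫ e ∈ E.effects (X ⊗ L)

theorem MultiEnvironment.deterministic_of_symmetry (E : MultiEnvironment C) {X Y : C} {σ : X ⟶ Y}
    (h : IsWirePermutation σ) : E.deterministic σ :=
  fun L _ he => E.symmetry_mem (h.whiskerRight L) he

instance (E : MultiEnvironment C) : E.deterministic.IsMultiplicative where
  id_mem X := E.deterministic_of_symmetry (.id X)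
  comp_mem f g hf hg L e he := by
    rw [comp_whiskerRight, Category.assoc]
    exact hf L _ (hg L e he)

theorem MultiEnvironment.deterministic_whiskerRight (E : MultiEnvironment C) {X Y : C} {f : X ⟶ Y}
    (hf : E.deterministic f) (K : C) : E.deterministic (f ▷ K) := by
  intro L e he
  have h : f ▷ K ▷ L ≫ e = (α_ X K L).hom ≫ f ▷ (K ⊗ L) ≫ (α_ Y K L).inv ≫ e := by simp
  rw [h]
  exact E.symmetry_mem (.associator_hom _ _ _)
    (hf _ _ (E.symmetry_mem (.associator_inv _ _ _) he))

instance (E : MultiEnvironment C) : E.deterministic.IsStableUnderBraiding where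
  whiskerLeft K _ _ f hf := by
    have h : K ◁ f = (β_ _ _).hom ≫ f ▷ K ≫ (β_ _ _).hom := by simp
    rw [h]
    exact E.deterministic.comp_mem _ _ (E.deterministic_of_symmetry (.braiding _ _))
      (E.deterministic.comp_mem _ _ (E.deterministic_whiskerRight hf K)
        (E.deterministic_of_symmetry (.braiding _ _)))
  whiskerRight _ hf K := E.deterministic_whiskerRight hf K
  associator_hom_mem _ _ _ := E.deterministic_of_symmetry (.associator_hom _ _ _)
  associator_inv_mem _ _ _ := E.deterministic_of_symmetry (.associator_inv _ _ _)
  leftUnitor_hom_mem _ := E.deterministic_of_symmetry (.leftUnitor_hom _)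
  leftUnitor_inv_mem _ := E.deterministic_of_symmetry (.leftUnitor_inv _)
  rightUnitor_hom_mem _ := E.deterministic_of_symmetry (.rightUnitor_hom _)
  rightUnitor_inv_mem _ := E.deterministic_of_symmetry (.rightUnitor_inv _)
  braiding_hom_mem _ _ := E.deterministic_of_symmetry (.braiding _ _)
  braiding_inv_mem X Y := by
    rw [← SymmetricCategory.braiding_swap_eq_inv_braiding]
    exact E.deterministic_of_symmetry (.braiding _ _)

/-- No-backwards-signalling: all discardings of the output induce the same discarding of the
input. -/
def MultiEnvironment.NoBackwardsSignalling (E : MultiEnvironment C) {X Y : C} (f : X ⟶ Y) : Prop :=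
  ∃ d ∈ E.effects X, ∀ e ∈ E.effects Y, f ≫ e = d

end ProcessTheory

/-! ### Pure and maximally mixed states -/

section States

variable {C : Type*} [Category* C] [MonoidalCategory C]
  [∀ X Y : C, AddCommMonoid (X ⟶ Y)] [∀ X Y : C, Module ℝ≥0 (X ⟶ Y)]
  {P : MorphismProperty C} [P.IsMonoidalStable]

/-- A state of the subtheory of processes satisfying `P` is pure if it is not a convex combination
of other states of that subtheory. -/
def IsPure {A : WideSubcategory P} (s : 𝟙_ (WideSubcategory P) ⟶ A) : Prop :=
  s.hom ∈ (Set.range fun t : 𝟙_ (WideSubcategory P) ⟶ A => t.hom).extremePoints ℝ≥0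

/-- A state of the subtheory of processes satisfying `P` is maximally mixed if every state of that
subtheory appears in a convex decomposition of it and it is invariant under the invertible
processes of that subtheory. -/
def IsMaximallyMixed {A : WideSubcategory P} (s : 𝟙_ (WideSubcategory P) ⟶ A) : Prop :=
  (∀ t : 𝟙_ (WideSubcategory P) ⟶ A, ∃ u : 𝟙_ (WideSubcategory P) ⟶ A,
    s.hom ∈ openSegment ℝ≥0 t.hom u.hom) ∧
  ∀ T : A ≅ A, s ≫ T.hom = s

end States

/-! ### Hyper-decoherence -/

section Hyperdecoherence

open Idempotents

/-- A choice of an idempotent on every system, compatible with the parallel composition, so that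
the systems `(X, map X)` of the idempotent splitting span a sub-process theory. -/
structure IdempotentFamily (D : Type*) [Category* D] [MonoidalCategory D] where
  /-- the idempotent on a system -/
  map : ∀ X : D, X ⟶ X
  idem : ∀ X, map X ≫ map X = map X
  map_unit : map (𝟙_ D) = 𝟙 _
  map_tensor : ∀ X Y, map (X ⊗ Y) = map X ⊗ₘ map Y

namespace IdempotentFamily

variable {D : Type*} [Category* D] [MonoidalCategory D] (h : IdempotentFamily D)

/-- The systems of the idempotent splitting of the form `(X, map X)`. -/
def chosen : ObjectProperty (Karoubi D) := fun Y => Y.p = h.map Y.X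

instance : h.chosen.IsMonoidal where
  prop_unit := h.map_unit.symm
  prop_tensor Y Z hY hZ := by
    change Y.p ⊗ₘ Z.p = h.map (Y.X ⊗ Z.X)
    rw [h.map_tensor, hY, hZ]

/-- The full sub-process theory of the idempotent splitting spanned by the systems
`(X, map X)`. -/
abbrev Hyp : Type _ := h.chosen.FullSubcategory

/-- The system `(X, map X)`. -/
def split (X : D) : h.Hyp := ⟨⟨X, h.map X, h.idem X⟩, rfl⟩

/-- The state `map X ∘ s` of the system `(X, map X)`. -/
def splitState {X : D} (s : 𝟙_ D ⟶ X) : 𝟙_ h.Hyp ⟶ h.split X :=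
  ObjectProperty.homMk ⟨s ≫ h.map X, by
    change 𝟙 _ ≫ (s ≫ h.map X) ≫ h.map X = s ≫ h.map X
    rw [Category.id_comp, Category.assoc, h.idem]⟩

end IdempotentFamily

variable {C : Type*} [Category* C] [MonoidalCategory C] [SymmetricCategory C]
  [∀ X Y : C, AddCommMonoid (X ⟶ Y)] [∀ X Y : C, Module ℝ≥0 (X ⟶ Y)]
  {C' : Type*} [Category* C'] [MonoidalCategory C'] [SymmetricCategory C']
  [∀ X Y : C', AddCommMonoid (X ⟶ Y)] [∀ X Y : C', Module ℝ≥0 (X ⟶ Y)]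

/-- Hyper-decoherence of the deterministic processes for the multi-environment structure `E` to the
theory of processes satisfying `P`. -/
structure HyperDecoherence (E : MultiEnvironment C) (P : MorphismProperty C')
    [P.IsStableUnderBraiding] extends IdempotentFamily (WideSubcategory E.deterministic) where
  noBackwardsSignalling : ∀ X, E.NoBackwardsSignalling (map X).hom
  /-- the equivalence of the theory of hyper-decohered systems with the target theory -/
  equiv : toIdempotentFamily.Hyp ⥤ WideSubcategory P
  [braided : equiv.Braided]
  full : equiv.Full
  faithful : equiv.Faithful
  essSurj : equiv.EssSurj
  /-- the equivalence respects convex mixtures of processes -/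
  map_mixture : ∀ {X Y : toIdempotentFamily.Hyp} (f g k : X ⟶ Y) (a b : ℝ≥0), a + b = 1 →
    k.hom.f.hom = a • f.hom.f.hom + b • g.hom.f.hom →
    (equiv.map k).hom = a • (equiv.map f).hom + b • (equiv.map g).hom
  /-- a state which hyper-decoheres to a pure state is pure -/
  copreserves_pure : ∀ {X} (s : 𝟙_ (WideSubcategory E.deterministic) ⟶ X),
    IsPure (Functor.LaxMonoidal.ε equiv ≫ equiv.map (toIdempotentFamily.splitState s)) → IsPure s
  /-- maximally mixed states hyper-decohere to maximally mixed states -/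
  preserves_maximallyMixed : ∀ {X} (s : 𝟙_ (WideSubcategory E.deterministic) ⟶ X),
    IsMaximallyMixed s →
    IsMaximallyMixed (Functor.LaxMonoidal.ε equiv ≫ equiv.map (toIdempotentFamily.splitState s))

end Hyperdecoherence

/-! ### Higher-order processes -/

/-- The systems of `D(C)`: formal tensor products of pairs `[H, H]`. -/
inductive Boxes (C : Type*) : Type _
  | box (H : C) : Boxes C
  | tensor (A B : Boxes C) : Boxes C

namespace Boxes

variable {C : Type*} [Category* C] [MonoidalCategory C]

/-- The system `⨂ (Hᵢ ⊗ Hᵢ)` underlying `⨂ [Hᵢ, Hᵢ]`; in each pair the first factor is the input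
(bottom) and the second factor is the output (top). -/
def wires : Boxes C → C
  | box H => H ⊗ H
  | tensor A B => wires A ⊗ wires B

instance : Category (Boxes C) where
  Hom A B := A.wires ⟶ B.wires
  id A := 𝟙 A.wires
  comp {A B D} f g := CategoryStruct.comp (X := A.wires) (Y := B.wires) (Z := D.wires) f g

/-- The processes of `D(C)` are processes of `C`. -/
def forget : Boxes C ⥤ C where
  obj := wires
  map f := f

instance : (forget (C := C)).Faithful where
  map_injective h := h

/-- An invertible process of `C` as an invertible process of `D(C)`. -/
def isoMk {A B : Boxes C} (e : A.wires ≅ B.wires) : A ≅ B :=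
  ⟨e.hom, e.inv, e.hom_inv_id, e.inv_hom_id⟩

instance : MonoidalCategoryStruct (Boxes C) where
  tensorObj := tensor
  tensorUnit := box (𝟙_ C)
  whiskerLeft A B D f := MonoidalCategoryStruct.whiskerLeft A.wires (Y₁ := B.wires) (Y₂ := D.wires) f
  whiskerRight {A B} f D := MonoidalCategoryStruct.whiskerRight (X₁ := A.wires) (X₂ := B.wires) f
    D.wires
  tensorHom {A B A' B'} f g := MonoidalCategoryStruct.tensorHom (X₁ := A.wires) (Y₁ := B.wires)
    (X₂ := A'.wires) (Y₂ := B'.wires) f g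
  associator A B D := isoMk (α_ A.wires B.wires D.wires)
  leftUnitor A := isoMk (whiskerRightIso (λ_ (𝟙_ C)) A.wires ≪≫ λ_ A.wires)
  rightUnitor A := isoMk (whiskerLeftIso A.wires (λ_ (𝟙_ C)) ≪≫ ρ_ A.wires)

/-- The monoidal structure of `D(C)` is that of `C`, up to `I ⊗ I ≅ I`. -/
def forgetData : Monoidal.InducingFunctorData (forget (C := C)) where
  μIso _ _ := Iso.refl _
  εIso := (λ_ (𝟙_ C)).symm
  whiskerLeft_eq _ _ _ _ := by
    exact ((Category.id_comp _).trans (Category.comp_id _)).symm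
  whiskerRight_eq _ _ := by
    exact ((Category.id_comp _).trans (Category.comp_id _)).symm
  tensorHom_eq _ _ := by
    exact ((Category.id_comp _).trans (Category.comp_id _)).symm
  associator_eq A B D := by
    change (α_ A.wires B.wires D.wires).hom = (𝟙 _ ≫ (𝟙 _ ⊗ₘ 𝟙 _)) ≫
      (α_ A.wires B.wires D.wires).hom ≫ ((𝟙 _ ⊗ₘ 𝟙 _) ≫ 𝟙 _)
    simp
  leftUnitor_eq A := by
    change (λ_ (𝟙_ C)).hom ▷ A.wires ≫ (λ_ A.wires).hom =
      (𝟙 _ ≫ ((λ_ (𝟙_ C)).hom ⊗ₘ 𝟙 _)) ≫ (λ_ A.wires).hom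
    simp
  rightUnitor_eq A := by
    change A.wires ◁ (λ_ (𝟙_ C)).hom ≫ (ρ_ A.wires).hom =
      (𝟙 _ ≫ (𝟙 _ ⊗ₘ (λ_ (𝟙_ C)).hom)) ≫ (ρ_ A.wires).hom
    simp

/-- The process theory `D(C)`. -/
instance : MonoidalCategory (Boxes C) := Monoidal.induced forget forgetData

instance : (forget (C := C)).Monoidal :=
  (Monoidal.fromInducedCoreMonoidal forget forgetData).toMonoidal

instance [BraidedCategory C] : BraidedCategory (Boxes C) :=
  .ofFaithful forget (fun A B => isoMk (β_ A.wires B.wires)) fun A B => by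
    change 𝟙 _ ≫ (β_ A.wires B.wires).hom = (β_ A.wires B.wires).hom ≫ 𝟙 _
    rw [Category.id_comp, Category.comp_id]

instance [SymmetricCategory C] : SymmetricCategory (Boxes C) where
  symmetry A B := SymmetricCategory.symmetry A.wires B.wires

end Boxes

noncomputable instance (A B : Boxes QSystem) : AddCommMonoid (A ⟶ B) :=
  inferInstanceAs (AddCommMonoid (A.wires ⟶ B.wires))

noncomputable instance (A B : Boxes QSystem) : Module ℝ≥0 (A ⟶ B) :=
  inferInstanceAs (Module ℝ≥0 (A.wires ⟶ B.wires))

/-! ### The theory of quantum boxes -/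

/-- The Choi operator of a map from operators on `ℂ^n` to operators on `ℂ^m`. -/
def choi {n m : Type} [DecidableEq n] (f : Matrix n n ℂ →ₗ[ℂ] Matrix m m ℂ) :
    Matrix (n × m) (n × m) ℂ :=
  Matrix.of fun p q => f (Matrix.single p.1 q.1 1) p.2 q.2

/-- The Choi operators of the families of local channels `Hᵢ → Hᵢ` on `⨂ [Hᵢ, Hᵢ]`. -/
def localChannels : ∀ A : Boxes QSystem, Set (Op A.wires)
  | .box H => {M | ∃ f : H ⟶ H, tracePreserving f ∧ M = choi (toLin f)}
  | .tensor A B => {M | ∃ M₁ ∈ localChannels A, ∃ M₂ ∈ localChannels B, M = M₁ ⊗ₖ M₂}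

/-- The process matrices on `⨂ [Hᵢ, Hᵢ]`: positive functionals giving unit probability on all
families of local channels. -/
def processMatrices (A : Boxes QSystem) : Set (A ⟶ 𝟙_ (Boxes QSystem)) :=
  {W | ∀ M ∈ localChannels A, toLin (X := A.wires) (Y := (𝟙_ (Boxes QSystem)).wires) W M = 1}

theorem tensorRight_kronecker {n m k : Type} (f : Matrix n n ℂ →ₗ[ℂ] Matrix m m ℂ)
    (M : Matrix n n ℂ) (N : Matrix k k ℂ) : tensorRight f k (M ⊗ₖ N) = f M ⊗ₖ N := by
  ext p q
  have h : (Matrix.of fun i j => (M ⊗ₖ N) (i, p.2) (j, q.2)) = N p.2 q.2 • M := by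
    ext i j
    exact mul_comm _ _
  change f (Matrix.of fun i j => (M ⊗ₖ N) (i, p.2) (j, q.2)) p.1 q.1 = f M p.1 q.1 * N p.2 q.2
  rw [h, map_smul, mul_comm]
  rfl

theorem relabel_prodComm_kronecker {n k : Type} (M : Matrix n n ℂ) (N : Matrix k k ℂ) :
    relabel (Equiv.prodComm n k) (M ⊗ₖ N) = N ⊗ₖ M := by
  ext p q
  exact mul_comm _ _

theorem tensorLeft_kronecker {n m k : Type} (f : Matrix n n ℂ →ₗ[ℂ] Matrix m m ℂ)
    (M : Matrix n n ℂ) (N : Matrix k k ℂ) : tensorLeft k f (N ⊗ₖ M) = N ⊗ₖ f M := by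
  change relabel _ (tensorRight f k (relabel (Equiv.prodComm k n) (N ⊗ₖ M))) = _
  rw [relabel_prodComm_kronecker, tensorRight_kronecker, relabel_prodComm_kronecker]

theorem unit_ext {M N : Op (𝟙_ (Boxes QSystem)).wires}
    (h : M ((), ()) ((), ()) = N ((), ()) ((), ())) : M = N :=
  Matrix.ext fun ⟨(), ()⟩ ⟨(), ()⟩ => h

theorem localChannels_unit : localChannels (𝟙_ (Boxes QSystem)) = {1} := by
  ext M
  constructor
  · rintro ⟨f, hf, rfl⟩
    have h : ∑ i : Unit, toLin f (Matrix.single () () 1) i i =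
        ∑ i : Unit, (Matrix.single () () (1 : ℂ) : Matrix Unit Unit ℂ) i i :=
      hf (Matrix.single () () 1)
    rw [Fintype.sum_unique, Fintype.sum_unique] at h
    exact unit_ext (h.trans (Matrix.single_apply_same () () (1 : ℂ)))
  · rintro rfl
    exact ⟨𝟙 _, fun _ => rfl, unit_ext (Matrix.single_apply_same () () (1 : ℂ)).symm⟩

/-- The linear map underlying a process of `D(CP)`. -/
abbrev boxLin {A B : Boxes QSystem} (f : A ⟶ B) : Op A.wires →ₗ[ℂ] Op B.wires :=
  toLin (X := A.wires) (Y := B.wires) f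

theorem boxLin_mem_localChannels {A B : Boxes QSystem} {σ : A ⟶ B} (h : IsWirePermutation σ) :
    ∀ M ∈ localChannels A, boxLin σ M ∈ localChannels B := by
  induction h with
  | id X => exact fun M hM => hM
  | comp _ _ ih₁ ih₂ => exact fun M hM => ih₂ _ (ih₁ M hM)
  | whiskerRight Z _ ih =>
    rintro _ ⟨M, hM, N, hN, rfl⟩
    exact ⟨_, ih M hM, N, hN, tensorRight_kronecker _ M N⟩
  | whiskerLeft Z _ ih =>
    rintro _ ⟨N, hN, M, hM, rfl⟩
    exact ⟨N, hN, _, ih M hM, tensorLeft_kronecker _ M N⟩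
  | associator_hom X Y Z =>
    rintro _ ⟨_, ⟨M, hM, N, hN, rfl⟩, K, hK, rfl⟩
    refine ⟨M, hM, _, ⟨N, hN, K, hK, rfl⟩, ?_⟩
    ext p q
    exact mul_assoc _ _ _
  | associator_inv X Y Z =>
    rintro _ ⟨M, hM, _, ⟨N, hN, K, hK, rfl⟩, rfl⟩
    refine ⟨_, ⟨M, hM, N, hN, rfl⟩, K, hK, ?_⟩
    ext p q
    exact (mul_assoc _ _ _).symm
  | leftUnitor_hom X =>
    rintro _ ⟨M, hM, N, hN, rfl⟩
    rw [localChannels_unit] at hM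
    obtain rfl := hM
    convert hN
    ext p q
    exact one_mul _
  | leftUnitor_inv X =>
    intro N hN
    refine ⟨1, by rw [localChannels_unit]; rfl, N, hN, ?_⟩
    ext p q
    exact (one_mul _).symm
  | rightUnitor_hom X =>
    rintro _ ⟨N, hN, M, hM, rfl⟩
    rw [localChannels_unit] at hM
    obtain rfl := hM
    convert hN
    ext p q
    exact mul_one _
  | rightUnitor_inv X =>
    intro N hN
    refine ⟨N, hN, 1, by rw [localChannels_unit]; rfl, ?_⟩
    ext p q
    exact (mul_one _).symm
  | braiding X Y =>
    rintro _ ⟨M, hM, N, hN, rfl⟩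
    exact ⟨N, hN, M, hM, relabel_prodComm_kronecker M N⟩

/-- The process matrices form a multi-environment structure on `D(CP)`. -/
def processEnvironment : MultiEnvironment (Boxes QSystem) where
  effects := processMatrices
  tensor_mem := by
    rintro X Y d e hd he _ ⟨M, hM, N, hN, rfl⟩
    change boxLin (λ_ (𝟙_ (Boxes QSystem))).hom (boxLin (d ⊗ₘ e) (M ⊗ₖ N)) = 1
    have h : boxLin (d ⊗ₘ e) (M ⊗ₖ N) = boxLin d M ⊗ₖ boxLin e N :=
      (congrArg (tensorLeft _ (boxLin e)) (tensorRight_kronecker (boxLin d) M N)).trans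
        (tensorLeft_kronecker _ _ _)
    have h₁ : boxLin d M = 1 := hd M hM
    have h₂ : boxLin e N = 1 := he N hN
    rw [h, h₁, h₂]
    exact unit_ext (mul_one (1 : ℂ))
  unit := by
    ext e
    constructor
    · intro he
      have h₁ : boxLin e 1 = 1 := he 1 (by rw [localChannels_unit]; rfl)
      refine hom_ext (X := (𝟙_ (Boxes QSystem)).wires) (Y := (𝟙_ (Boxes QSystem)).wires) fun M => ?_
      have hM : M = M ((), ()) ((), ()) • (1 : Op (𝟙_ (Boxes QSystem)).wires) :=
        unit_ext (mul_one _).symm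
      change boxLin e M = M
      rw [hM, map_smul, h₁]
    · rintro rfl M hM
      rw [localChannels_unit] at hM
      exact hM
  symmetry_mem hσ he M hM := he _ (boxLin_mem_localChannels hσ M hM)

/-- The theory of quantum boxes: the deterministic processes of `D(CP)`. -/
abbrev QBox : Type 1 := WideSubcategory processEnvironment.deterministic

/-- The completely depolarising process of a system. -/
noncomputable def depolariseProcess (H : QSystem) : H ⟶ H :=
  ⟨depolarise H.ι, isCompletelyPositive_depolarise H.ι⟩

/-- The process of `D(CP)` which completely depolarises the input side of every box and is the
identity on the output side. -/
noncomputable def hypdec : ∀ A : Boxes QSystem, A ⟶ A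
  | .box H => depolariseProcess H ▷ H
  | .tensor A B => hypdec A ⊗ₘ hypdec B

end QuantumBox

/-!
# Quantum boxes hyper-decohere to quantum theory

Sort the wires of `A = ⨂ [Hᵢ, Hᵢ]` into inputs and outputs. The hyper-decoherence map of `A` factors
as `extr A ≫ prep A` (`extr_comp_prep`), where `extr A` is the normalised partial trace over the
inputs, with values in the operators of the outputs `outs A`, and `prep A` is `σ ↦ 1 ⊗ σ`. Since
`prep A ≫ extr A = 𝟙` (`prep_comp_extr`), this splits the idempotent through `outs A` in `CP`, and
all the structure of the splitting is transported to `CP` by `f ↦ prep ≫ f ≫ extr`.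

Two facts relate this to determinism. A process matrix applied to `1 ⊗ σ` gives `tr σ`
(`boxLin_prep`, and `boxLin_prep_kronecker` in the presence of further boxes): this holds when `σ`
is a product of density matrices, because `1 ⊗ σ` is then a family of local channels with constant
output, and these products span all operators. This gives no-backwards-signalling, and shows that
every channel `g : outs A ⟶ outs B` yields a deterministic process `extr A ≫ g ≫ prep B`.
Conversely, discarding the outputs after feeding a state `ρ` into the inputs is a process matrix
(`inputEffect`). For maximally mixed `ρ` this shows that a deterministic process induces a
trace-preserving map of the outputs; together these give the equivalence `outputFunctor` with `CPTP`.

Purity: testing a deterministic state against all `inputEffect`s shows that its input marginal is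
the identity. If its output marginal is a rank one projection, the state is therefore the product
of the two (`eq_of_marginals`), so that it is determined by its hyper-decohered version, and a
decomposition of it would decompose the latter.

Maximally mixed states: the family of completely depolarising channels is a positive multiple `c 1`
of the identity, hence interior to the positive cone, and every deterministic state occurs in a
decomposition of it. An invertible deterministic process and its inverse preserve `tr 1`; being
completely positive, it is `M ↦ V M Vᴴ` up to a scalar, and `tr (V Vᴴ) = tr ((V Vᴴ)⁻¹) = tr 1` forces
`V Vᴴ = 1`, so `c 1` is invariant (`IsCompletelyPositive.map_one_of_inverse`). Conversely, local
invertible channels on the outputs are invertible deterministic processes, and invariance under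
them forces the output marginal to be proportional to the identity (`depolariseOutputs_eq_self`).
-/

namespace QuantumBox

/-! ### Positive matrices -/

section Matrices

open Matrix

variable {n m k : Type}

/-- A positive matrix is a Gram matrix. -/
theorem exists_gram [Fintype n] {M : Matrix n n ℂ} (hM : M.PosSemidef) :
    ∃ B : Matrix n n ℂ, M = Bᴴ * B := by
  classical
  open scoped MatrixOrder Matrix.Norms.L2Operator in
  exact CStarAlgebra.nonneg_iff_eq_star_mul_self.mp hM.nonneg

/-- A linear functional which is constant on density matrices is a multiple of the trace, since
density matrices span all matrices. -/
theorem eq_mul_trace_of_density [Fintype n] (φ : Matrix n n ℂ →ₗ[ℂ] ℂ) (c : ℂ)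
    (h : ∀ ρ : Matrix n n ℂ, ρ.PosSemidef → ρ.trace = 1 → φ ρ = c) (M : Matrix n n ℂ) :
    φ M = c * M.trace := by
  classical
  have hpos (P : Matrix n n ℂ) (hP : P.PosSemidef) : φ P = c * P.trace := by
    by_cases h0 : P.trace = 0
    · rw [h0, hP.trace_eq_zero_iff.mp h0]
      simp
    · have h1 := h (P.trace⁻¹ • P) (hP.smul (inv_nonneg.mpr hP.trace_nonneg))
        (by rw [trace_smul, smul_eq_mul, inv_mul_cancel₀ h0])
      rw [map_smul, smul_eq_mul, inv_mul_eq_iff_eq_mul₀ h0] at h1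
      rw [h1, mul_comm]
  -- polarisation recovers the matrix units from the projections onto `eᵢ + ω eⱼ`
  have hvec (i j : n) (ω : ℂ) : φ (vecMulVec (Pi.single i 1 + ω • Pi.single j 1)
      (star (Pi.single i 1 + ω • Pi.single j 1))) = c * (vecMulVec
      (Pi.single i 1 + ω • Pi.single j 1) (star (Pi.single i 1 + ω • Pi.single j 1))).trace :=
    hpos _ (posSemidef_vecMulVec_self_star _)
  have hsingle (i j : n) : φ (single i j 1) = c * (single i j (1 : ℂ)).trace := by
    have e (ω : ℂ) : vecMulVec (Pi.single i 1 + ω • Pi.single j 1)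
        (star (Pi.single i 1 + ω • Pi.single j 1)) = single i i 1 + star ω • single i j 1 +
        ω • single j i 1 + (ω * star ω) • single j j (1 : ℂ) := by
      ext a b
      simp only [vecMulVec_apply, Matrix.add_apply, Matrix.smul_apply, Pi.add_apply, Pi.smul_apply,
        Pi.star_apply, star_add, star_smul, smul_eq_mul, single_apply, Pi.single_apply]
      have hz (p q : n) : star (if p = q then (1 : ℂ) else 0) = if q = p then 1 else 0 := by
        split_ifs <;> simp_all
      have hm (p q : Prop) [Decidable p] [Decidable q] : (if p ∧ q then (1 : ℂ) else 0) =
          (if p then 1 else 0) * if q then 1 else 0 := by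
        split_ifs <;> simp_all
      simp only [hz, hm, eq_comm (b := a)]
      ring
    have h1 := hvec i j 1
    have h2 := hvec i j (-1)
    have h3 := hvec i j Complex.I
    have h4 := hvec i j (-Complex.I)
    simp only [e, map_add, map_smul, trace_add, trace_smul, smul_eq_mul] at h1 h2 h3 h4
    simp only [star_one, star_neg, Complex.star_def, Complex.conj_I] at h1 h2 h3 h4
    linear_combination (h1 - h2 + Complex.I * (h3 - h4)) / 4 + (φ (single i j 1) -
      φ (single j i 1) - c * (single i j (1 : ℂ)).trace + c * (single j i (1 : ℂ)).trace) / 2 *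
      Complex.I_mul_I
  rw [matrix_eq_sum_single M]
  simp only [map_sum, trace_sum, Finset.mul_sum]
  refine Finset.sum_congr rfl fun i _ => Finset.sum_congr rfl fun j _ => ?_
  rw [← mul_one (M i j), ← smul_eq_mul, ← smul_single, map_smul, hsingle, trace_smul]
  simp only [smul_eq_mul]
  ring

/-- The identity matrix lies in the interior of the cone of positive matrices. -/
theorem exists_pos_smul_one_sub [Fintype n] [DecidableEq n] {t : Matrix n n ℂ} (ht : t.PosSemidef)
    {c : ℝ} (hc : 0 < c) : ∃ a : ℝ, 0 < a ∧ a < 1 ∧ (c • (1 : Matrix n n ℂ) - a • t).PosSemidef := by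
  obtain ⟨r, hr, h⟩ : ∃ r : ℝ, 0 ≤ r ∧ (r • (1 : Matrix n n ℂ) - t).PosSemidef := by
    open scoped MatrixOrder Matrix.Norms.L2Operator in
    refine ⟨‖t‖, norm_nonneg t, ?_⟩
    have := IsSelfAdjoint.le_algebraMap_norm_self (a := t) ht.1
    rw [Algebra.algebraMap_eq_smul_one] at this
    exact this
  refine ⟨min (1 / 2) (c / (r + 1)), by positivity, (min_le_left _ _).trans_lt (by norm_num), ?_⟩
  set a := min (1 / 2) (c / (r + 1))
  have ha : 0 ≤ a := by positivity
  have h2 : 0 ≤ c - a * r := by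
    have : a * (r + 1) ≤ c := (le_div_iff₀ (by positivity)).mp (min_le_right _ _)
    nlinarith
  have h3 : c • (1 : Matrix n n ℂ) - a • t =
      a • (r • (1 : Matrix n n ℂ) - t) + (c - a * r) • (1 : Matrix n n ℂ) := by
    rw [smul_sub, smul_smul, sub_smul]
    abel
  rw [h3]
  exact (h.smul ha).add (PosSemidef.one.smul h2)

/-- A density matrix which is not a proper mixture of density matrices has rank one. -/
theorem exists_vecMulVec_of_extreme [Fintype n] {ρ : Matrix n n ℂ} (hρ : ρ.PosSemidef)
    (htr : ρ.trace = 1)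
    (hext : ∀ σ τ : Matrix n n ℂ, σ.PosSemidef → σ.trace = 1 → τ.PosSemidef → τ.trace = 1 →
      ∀ a b : ℝ, 0 < a → 0 < b → a + b = 1 → a • σ + b • τ = ρ → σ = ρ) :
    ∃ v : n → ℂ, ρ = vecMulVec v (star v) ∧ v ⬝ᵥ star v = 1 := by
  classical
  obtain ⟨B, hB⟩ := exists_gram hρ
  have hsum : ρ = ∑ l, vecMulVec (star (B l)) (star (star (B l))) := by
    ext i j
    simp [hB, mul_apply, Matrix.sum_apply, vecMulVec_apply]
  have hl : ∃ l, B l ≠ 0 := by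
    by_contra! h
    simp [hsum, h] at htr
  obtain ⟨l, hl⟩ := hl
  set w := star (B l) with hw
  have hw0 : w ≠ 0 := by simpa [hw] using hl
  obtain ⟨c, hc⟩ : ∃ c : ℝ, (c : ℂ) = w ⬝ᵥ star w := by
    refine ⟨∑ i, ‖w i‖ ^ 2, ?_⟩
    simp [dotProduct, Complex.mul_conj, Complex.normSq_eq_norm_sq]
  have hcpos : 0 < c := by
    have : 0 < w ⬝ᵥ star w := by
      rw [dotProduct_comm]
      exact dotProduct_star_self_pos_iff.mpr hw0
    rw [← hc] at this
    exact_mod_cast this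
  have hrest : (ρ - vecMulVec w (star w)).PosSemidef := by
    have : ρ - vecMulVec w (star w) =
        ∑ l ∈ Finset.univ.erase l, vecMulVec (star (B l)) (star (star (B l))) := by
      rw [hsum, ← Finset.add_sum_erase _ _ (Finset.mem_univ l), ← hw, add_sub_cancel_left]
    rw [this]
    exact posSemidef_sum _ fun _ _ => posSemidef_vecMulVec_self_star _
  have htrest : (ρ - vecMulVec w (star w)).trace = ((1 - c : ℝ) : ℂ) := by
    rw [trace_sub, htr, trace_vecMulVec, ← hc]
    push_cast
    rfl
  have hc1 : c ≤ 1 := by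
    have := hrest.trace_nonneg
    rw [htrest] at this
    have : 0 ≤ 1 - c := by exact_mod_cast this
    linarith
  rcases hc1.eq_or_lt with rfl | hlt
  · refine ⟨w, ?_, by rw [← hc]; simp⟩
    rw [sub_self, Complex.ofReal_zero] at htrest
    exact sub_eq_zero.mp (hrest.trace_eq_zero_iff.mp htrest)
  · have hd : 0 < 1 - c := by linarith
    have hc0 : (c : ℂ) ≠ 0 := by exact_mod_cast hcpos.ne'
    have hd0 : ((1 - c : ℝ) : ℂ) ≠ 0 := by exact_mod_cast hd.ne'
    have key := hext (c⁻¹ • vecMulVec w (star w)) ((1 - c)⁻¹ • (ρ - vecMulVec w (star w)))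
      ((posSemidef_vecMulVec_self_star w).smul (by positivity))
      (by rw [trace_smul, trace_vecMulVec, ← hc, Complex.real_smul, Complex.ofReal_inv,
        inv_mul_cancel₀ hc0])
      (hrest.smul (by positivity))
      (by rw [trace_smul, htrest, Complex.real_smul, Complex.ofReal_inv, inv_mul_cancel₀ hd0])
      c (1 - c) hcpos hd (by ring)
      (by rw [smul_smul, smul_smul, mul_inv_cancel₀ hcpos.ne', mul_inv_cancel₀ hd.ne']; simp)
    obtain ⟨x, hx⟩ : ∃ x : ℝ, x * x = c⁻¹ :=
      ⟨Real.sqrt c⁻¹, Real.mul_self_sqrt (inv_nonneg.mpr hcpos.le)⟩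
    have hx' : (x : ℂ) * x = (c : ℂ)⁻¹ := by exact_mod_cast hx
    have hv : star ((x : ℂ) • w) = (x : ℂ) • star w := by simp [star_smul]
    refine ⟨(x : ℂ) • w, ?_, ?_⟩
    · rw [← key, hv, smul_vecMulVec, vecMulVec_smul, smul_smul, hx', ← Complex.ofReal_inv]
      rfl
    · rw [hv, smul_dotProduct, dotProduct_smul, smul_smul, hx', ← hc, smul_eq_mul,
        inv_mul_cancel₀ hc0]

/-- A bipartite positive operator one of whose marginals is pure is a product; if the other
marginal is the identity, this determines the operator. -/
theorem eq_of_marginals [Fintype n] [DecidableEq n] [Fintype k] {M : Matrix (n × k) (n × k) ℂ}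
    (hM : M.PosSemidef) {c : ℂ} {v : k → ℂ} (hv : v ⬝ᵥ star v = 1)
    (h₂ : ∀ x y, ∑ i, M (i, x) (i, y) = c * (v x * star (v y)))
    (h₁ : ∀ i j, ∑ x, M (i, x) (j, x) = (1 : Matrix n n ℂ) i j) :
    M = (1 : Matrix n n ℂ) ⊗ₖ vecMulVec v (star v) := by
  classical
  obtain ⟨B, hB⟩ := exists_gram hM
  have hM' (p q) : M p q = ∑ l, star (B l p) * B l q := by simp [hB, mul_apply]
  -- the vectors of `ℂ^k` which the Gram vectors of `M` contribute to the second marginal, as the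
  -- columns of a matrix; the projection `Q` orthogonal to `v` kills them
  let R : Matrix k ((n × k) × n) ℂ := Matrix.of fun x l => star (B l.1 (l.2, x))
  have hR : R * Rᴴ = c • vecMulVec v (star v) := by
    ext x y
    have := h₂ x y
    simp only [hM'] at this
    rw [Finset.sum_comm] at this
    simpa [R, mul_apply, Fintype.sum_prod_type, vecMulVec_apply] using this
  let Q : Matrix k k ℂ := 1 - vecMulVec v (star v)
  have hQv : Q * vecMulVec v (star v) = 0 := by
    rw [Matrix.sub_mul, Matrix.one_mul, vecMulVec_mul_vecMulVec]
    rw [dotProduct_comm, hv]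
    simp
  have hQR : Q * R = 0 := by
    rw [← self_mul_conjTranspose_eq_zero]
    rw [conjTranspose_mul, Matrix.mul_assoc, ← Matrix.mul_assoc R, hR, ← Matrix.mul_assoc,
      mul_smul_comm, hQv]
    simp
  have hα (l : n × k) (i : n) (x : k) : star (B l (i, x)) =
      v x * ∑ y, star (v y) * star (B l (i, y)) := by
    have := congrFun (congrFun hQR x) (l, i)
    simp only [Q, Matrix.sub_mul, Matrix.one_mul, Matrix.sub_apply, Matrix.zero_apply,
      sub_eq_zero, R, Matrix.of_apply] at this
    rw [this, mul_apply, Finset.mul_sum]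
    exact Finset.sum_congr rfl fun y _ => by simp [vecMulVec_apply, mul_assoc]
  set α : n × k → n → ℂ := fun l i => ∑ y, star (v y) * star (B l (i, y)) with hαdef
  have hM'' (i j x y) : M (i, x) (j, y) = (∑ l, α l i * star (α l j)) * (v x * star (v y)) := by
    rw [hM', Finset.sum_mul]
    refine Finset.sum_congr rfl fun l _ => ?_
    rw [← star_star (B l (j, y)), hα l i x, hα l j y, star_mul]
    ring
  ext ⟨i, x⟩ ⟨j, y⟩
  have h := h₁ i j
  simp only [hM'', ← Finset.mul_sum] at h
  have hv' : ∑ x, v x * star (v x) = 1 := hv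
  rw [hv', mul_one] at h
  rw [hM'', h]
  rfl

end Matrices

/-! ### Completely positive maps -/

section CompletelyPositive

open Matrix

variable {n m k : Type}

/-- The map `M ↦ K M Kᴴ` with a single Kraus operator `K`. -/
def conjBy [Fintype n] (K : Matrix m n ℂ) : Matrix n n ℂ →ₗ[ℂ] Matrix m m ℂ where
  toFun M := K * M * Kᴴ
  map_add' M N := by rw [Matrix.mul_add, Matrix.add_mul]
  map_smul' c M := by simp

theorem isCompletelyPositive_conjBy [Finite m] [Fintype n] (K : Matrix m n ℂ) :
    IsCompletelyPositive (conjBy K) := by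
  intro k _ M hM
  have := Fintype.ofFinite k
  classical
  suffices h : QuantumBox.tensorRight (conjBy K) k M =
      (K ⊗ₖ (1 : Matrix k k ℂ)) * M * (K ⊗ₖ (1 : Matrix k k ℂ))ᴴ by
    rw [h]
    exact hM.mul_mul_conjTranspose_same _
  ext ⟨a, c⟩ ⟨b, d⟩
  change (K * (_ : Matrix n n ℂ) * Kᴴ) a b = _
  simp [mul_apply, Fintype.sum_prod_type, one_apply, Finset.sum_mul, kroneckerMap_apply,
    apply_ite (starRingEnd ℂ)]

/-- The functional `M ↦ tr (P M)`, with values in the scalar operators of any system. -/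
def traceWith [Fintype n] (P : Matrix n n ℂ) (m : Type) : Matrix n n ℂ →ₗ[ℂ] Matrix m m ℂ where
  toFun M := Matrix.of fun _ _ => (P * M).trace
  map_add' M N := by
    ext
    simp [Matrix.mul_add]
  map_smul' c M := by
    ext
    simp

theorem isCompletelyPositive_traceWith [Fintype n] {P : Matrix n n ℂ} (hP : P.PosSemidef)
    (m : Type) : IsCompletelyPositive (traceWith P m) := by
  intro k _ M hM
  obtain ⟨B, rfl⟩ := exists_gram hP
  have h : QuantumBox.tensorRight (traceWith (Bᴴ * B) m) k M = ∑ l, (QuantumBox.tensorRight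
      (conjBy B) k M).submatrix (fun p : m × k => (l, p.2)) fun p => (l, p.2) := by
    ext ⟨a, c⟩ ⟨b, d⟩
    rw [Matrix.sum_apply]
    change (Bᴴ * B * _).trace = _
    rw [Matrix.mul_assoc, trace_mul_comm]
    rfl
  rw [h]
  exact posSemidef_sum _ fun l _ => (isCompletelyPositive_conjBy B k M hM).submatrix _

/-- The preparation of the operator `ρ`, as a map which multiplies `ρ` by a diagonal entry of the
argument. -/
def preparation (u : m) (ρ : Matrix n n ℂ) : Matrix m m ℂ →ₗ[ℂ] Matrix n n ℂ where
  toFun M := M u u • ρ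
  map_add' M N := by rw [Matrix.add_apply, add_smul]
  map_smul' c M := by rw [Matrix.smul_apply, smul_assoc]; rfl

theorem isCompletelyPositive_preparation [Finite n] (u : m) {ρ : Matrix n n ℂ}
    (hρ : ρ.PosSemidef) : IsCompletelyPositive (preparation u ρ) := by
  intro k _ M hM
  have := Fintype.ofFinite k
  have := Fintype.ofFinite n
  suffices h : QuantumBox.tensorRight (preparation u ρ) k M =
      ρ ⊗ₖ M.submatrix (fun c : k => (u, c)) fun c => (u, c) by
    rw [h]
    exact hρ.kronecker (hM.submatrix _)
  ext ⟨a, c⟩ ⟨b, d⟩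
  exact mul_comm _ _

theorem IsCompletelyPositive.posSemidef {f : Matrix n n ℂ →ₗ[ℂ] Matrix m m ℂ}
    (hf : IsCompletelyPositive f) {M : Matrix n n ℂ} (hM : M.PosSemidef) : (f M).PosSemidef :=
  (hf Unit _ (hM.submatrix (Prod.fst : n × Unit → n))).submatrix fun a : m => (a, ())

/-- The Kraus decomposition, read off from a Gram decomposition of the Choi operator. -/
theorem IsCompletelyPositive.exists_kraus [Fintype n] [DecidableEq n] [Fintype m]
    {f : Matrix n n ℂ →ₗ[ℂ] Matrix m m ℂ} (hf : IsCompletelyPositive f) :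
    ∃ K : m × n → Matrix m n ℂ, ∀ M, f M = ∑ l, K l * M * (K l)ᴴ := by
  -- the (unnormalised) maximally entangled vector
  let ω : n × n → ℂ := fun p => if p.1 = p.2 then 1 else 0
  obtain ⟨B, hB⟩ := exists_gram (hf n _ (posSemidef_vecMulVec_self_star ω))
  refine ⟨fun l => Matrix.of fun a i => star (B l (a, i)), fun M => ?_⟩
  have hf' (i j : n) (a b : m) : f (single i j 1) a b = ∑ l, star (B l (a, i)) * B l (b, j) := by
    have h := congrFun (congrFun hB (a, i)) (b, j)
    rw [mul_apply] at h
    simp only [conjTranspose_apply] at h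
    rw [← h]
    change _ = f (Matrix.of fun i' j' => vecMulVec ω (star ω) (i', i) (j', j)) a b
    refine congrFun (congrFun (congrArg f ?_) a) b
    ext i' j'
    simp only [single_apply, of_apply, vecMulVec_apply, ω, Pi.star_apply]
    by_cases h1 : i = i' <;> by_cases h2 : j = j' <;> simp [h1, h2, eq_comm]
  ext a b
  rw [apply_eq_sum, Matrix.sum_apply]
  simp only [hf', mul_apply, of_apply, conjTranspose_apply, Finset.mul_sum, Finset.sum_mul,
    star_star]
  rw [Finset.sum_comm]
  simp_rw [Finset.sum_comm (s := (Finset.univ : Finset n)) (t := (Finset.univ : Finset (m × n)))]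
  exact Finset.sum_congr rfl fun l _ => Finset.sum_congr rfl fun j _ =>
    Finset.sum_congr rfl fun i _ => by ring

/-- All Kraus operators of the identity are scalar. -/
theorem eq_smul_one_of_kraus_id [Fintype n] [DecidableEq n] [Nonempty n] {ι : Type} [Fintype ι]
    {A : ι → Matrix n n ℂ} (h : ∀ M, ∑ l, A l * M * (A l)ᴴ = M) :
    ∃ c : ι → ℂ, (∀ l, A l = c l • 1) ∧ ∑ l, c l * star (c l) = 1 := by
  have hE (i j a b : n) : ∑ l, A l a i * star (A l b j) = single i j (1 : ℂ) a b := by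
    conv_rhs => rw [← h (single i j 1)]
    rw [Matrix.sum_apply]
    refine Finset.sum_congr rfl fun l _ => ?_
    simp [mul_apply, single_apply, ite_and]
  have hsq {x : ι → ℂ} (hx : ∑ l, x l * star (x l) = 0) (l : ι) : x l = 0 :=
    congrFun (dotProduct_self_star_eq_zero.mp hx) l
  have hoff (l : ι) {i j : n} (hij : i ≠ j) : A l i j = 0 := by
    refine hsq (x := fun l => A l i j) ((hE j j i i).trans ?_) l
    rw [single_apply_of_ne]
    exact fun h => hij h.1.symm
  have hdiag (l : ι) (i j : n) : A l i i = A l j j := by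
    have key : ∑ l, (A l i i - A l j j) * star (A l i i - A l j j) = 0 := by
      have e (l : ι) : (A l i i - A l j j) * star (A l i i - A l j j) =
          A l i i * star (A l i i) - A l i i * star (A l j j) - A l j j * star (A l i i) +
            A l j j * star (A l j j) := by
        rw [star_sub]
        ring
      simp only [e, Finset.sum_add_distrib, Finset.sum_sub_distrib, hE, single_apply_same]
      ring
    exact sub_eq_zero.mp (hsq (x := fun l => A l i i - A l j j) key l)
  obtain ⟨i₀⟩ := ‹Nonempty n›
  refine ⟨fun l => A l i₀ i₀, fun l => ?_, (hE i₀ i₀ i₀ i₀).trans (single_apply_same _ _ _)⟩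
  ext i j
  by_cases hij : i = j
  · subst hij
    simp [hdiag l i i₀]
  · simp [hoff l hij, hij]

/-- An invertible completely positive map such that it and its inverse preserve the trace of the
identity is unital: it has a single Kraus operator `V`, and `tr (V Vᴴ) = tr ((V Vᴴ)⁻¹) = tr 1`
forces `V Vᴴ = 1`. -/
theorem IsCompletelyPositive.map_one_of_inverse [Fintype n] [DecidableEq n] [Nonempty n]
    {f g : Matrix n n ℂ →ₗ[ℂ] Matrix n n ℂ} (hf : IsCompletelyPositive f)
    (hg : IsCompletelyPositive g) (hgf : ∀ M, g (f M) = M)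
    (htf : (f 1).trace = (1 : Matrix n n ℂ).trace) (htg : (g 1).trace = (1 : Matrix n n ℂ).trace) :
    f 1 = 1 := by
  obtain ⟨K, hK⟩ := hf.exists_kraus
  obtain ⟨L, hL⟩ := hg.exists_kraus
  obtain ⟨c, hc, hc1⟩ := eq_smul_one_of_kraus_id (A := fun p : (n × n) × (n × n) => L p.1 * K p.2)
    fun M => by
      conv_rhs => rw [← hgf M, hL, hK]
      simp [Fintype.sum_prod_type, Matrix.mul_sum, Matrix.sum_mul, Matrix.mul_assoc]
  -- one of the scalars is nonzero, so the Kraus operators of `f` are multiples of a single one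
  obtain ⟨⟨j, i⟩, hji⟩ : ∃ p, c p ≠ 0 := by
    by_contra! h
    simp [h] at hc1
  set V := K i
  set U := L j
  set d := c (j, i)
  have hUV : U * V = d • 1 := hc (j, i)
  have hVU : V * U = d • 1 := by
    have h1 : (d⁻¹ • U) * V = 1 := by
      rw [smul_mul_assoc, hUV, smul_smul, inv_mul_cancel₀ hji, one_smul]
    have h2 := mul_eq_one_comm.mp h1
    rw [mul_smul_comm, inv_smul_eq_iff₀ hji] at h2
    exact h2
  have hKl (l) : K l = (d⁻¹ * c (j, l)) • V := by
    have h := congrArg (V * ·) (hc (j, l))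
    simp only [← Matrix.mul_assoc] at h
    rw [show V * L j = d • 1 from hVU, smul_mul_assoc, Matrix.one_mul, mul_smul_comm,
      Matrix.mul_one] at h
    rw [mul_smul, ← h, smul_smul, inv_mul_cancel₀ hji, one_smul]
  have hLl (l) : L l = (d⁻¹ * c (l, i)) • U := by
    have h := congrArg (· * U) (hc (l, i))
    simp only [Matrix.mul_assoc] at h
    rw [show K i * U = d • 1 from hVU, smul_mul_assoc, Matrix.one_mul, mul_smul_comm,
      Matrix.mul_one] at h
    rw [mul_smul, ← h, smul_smul, inv_mul_cancel₀ hji, one_smul]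
  obtain ⟨s, hs⟩ : ∃ s : ℂ, ∀ M, f M = s • (V * M * Vᴴ) := by
    refine ⟨∑ l, (d⁻¹ * c (j, l)) * star (d⁻¹ * c (j, l)), fun M => ?_⟩
    rw [hK, Finset.sum_smul]
    exact Finset.sum_congr rfl fun l _ => by
      rw [hKl, conjTranspose_smul, smul_mul_assoc, smul_mul_assoc, mul_smul_comm, smul_smul]
  obtain ⟨t, ht⟩ : ∃ t : ℂ, ∀ M, g M = t • (U * M * Uᴴ) := by
    refine ⟨∑ l, (d⁻¹ * c (l, i)) * star (d⁻¹ * c (l, i)), fun M => ?_⟩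
    rw [hL, Finset.sum_smul]
    exact Finset.sum_congr rfl fun l _ => by
      rw [hLl, conjTranspose_smul, smul_mul_assoc, smul_mul_assoc, mul_smul_comm, smul_smul]
  have hVU' : Uᴴ * Vᴴ = star d • 1 := by
    rw [← conjTranspose_mul, hVU, conjTranspose_smul, conjTranspose_one]
  have hUV' : Vᴴ * Uᴴ = star d • 1 := by
    rw [← conjTranspose_mul, hUV, conjTranspose_smul, conjTranspose_one]
  have hst : s * t * (d * star d) = 1 := by
    have h := hgf 1
    rw [ht, hs] at h
    have e : U * s • (V * 1 * Vᴴ) * Uᴴ = (s * (d * star d)) • (1 : Matrix n n ℂ) := by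
      rw [mul_smul_comm, smul_mul_assoc, Matrix.mul_one, ← Matrix.mul_assoc, hUV, Matrix.mul_assoc,
        hUV', smul_mul_smul_comm, Matrix.one_mul, smul_smul]
    rw [e, smul_smul] at h
    have h' := congrFun (congrFun h (Classical.arbitrary n)) (Classical.arbitrary n)
    rw [Matrix.smul_apply, one_apply_eq, smul_eq_mul, mul_one] at h'
    linear_combination h'
  have hs0 : s ≠ 0 := fun h => by simp [h] at hst
  rw [hs, Matrix.mul_one, trace_smul, smul_eq_mul] at htf
  rw [ht, Matrix.mul_one, trace_smul, trace_mul_comm, smul_eq_mul] at htg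
  -- `V Vᴴ` is scalar iff `V` is proportional to `Uᴴ`; the factor `t d` is the only one for which
  -- `f 1 = 1`, and the three trace identities `htf`, `htg`, `hst` make the difference vanish
  have htr : ((V - (t * d) • Uᴴ) * (V - (t * d) • Uᴴ)ᴴ).trace = 0 := by
    rw [conjTranspose_sub, conjTranspose_smul, conjTranspose_conjTranspose, Matrix.sub_mul,
      Matrix.mul_sub, Matrix.mul_sub, smul_mul_assoc, smul_mul_assoc, mul_smul_comm, mul_smul_comm,
      hVU, hVU', trace_sub, trace_sub, trace_sub]
    simp only [trace_smul, smul_eq_mul]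
    refine mul_left_cancel₀ hs0 ?_
    linear_combination htf + s * d * star (t * d) * htg - trace (1 : Matrix n n ℂ) * hst
  have hV : V = (t * d) • Uᴴ := sub_eq_zero.mp (trace_mul_conjTranspose_self_eq_zero_iff.mp htr)
  rw [hs, Matrix.mul_one]
  nth_rw 1 [hV]
  rw [smul_mul_assoc, hVU', smul_smul, smul_smul]
  rw [show s * (t * d) * star d = 1 by linear_combination hst, one_smul]

end CompletelyPositive

/-! ### Inputs and outputs of a system of boxes -/

section Wires

open Matrix

/-- The input wires of `⨂ [Hᵢ, Hᵢ]`. -/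
def ins : Boxes QSystem → QSystem
  | .box H => H
  | .tensor A B => ins A ⊗ ins B

/-- The output wires of `⨂ [Hᵢ, Hᵢ]`. -/
def outs : Boxes QSystem → QSystem
  | .box H => H
  | .tensor A B => outs A ⊗ outs B

/-- The sorting of the wires of `⨂ [Hᵢ, Hᵢ]` into inputs and outputs. -/
def sortWires : ∀ A : Boxes QSystem, A.wires.ι ≃ (ins A).ι × (outs A).ι
  | .box H => Equiv.refl (H.ι × H.ι)
  | .tensor A B => (Equiv.prodCongr (sortWires A) (sortWires B)).trans
      (Equiv.prodProdProdComm (ins A).ι (outs A).ι (ins B).ι (outs B).ι)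

/-- The preparation of the unnormalised operator `1`. -/
def prepareOne (H : QSystem) : 𝟙_ QSystem ⟶ H :=
  ⟨preparation () 1, isCompletelyPositive_preparation () PosSemidef.one⟩

/-- The trace divided by the dimension. -/
noncomputable def normalisedTrace (H : QSystem) : H ⟶ 𝟙_ QSystem :=
  ⟨traceWith (((Fintype.card H.ι : ℂ)⁻¹) • 1) Unit, isCompletelyPositive_traceWith
    (PosSemidef.one.smul (inv_nonneg.mpr (Nat.cast_nonneg _))) Unit⟩

theorem toLin_normalisedTrace (H : QSystem) (M : Op H) :
    toLin (normalisedTrace H) M () () = (Fintype.card H.ι : ℂ)⁻¹ * M.trace := by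
  change (_ • (1 : Op H) * M).trace = _
  rw [smul_mul_assoc, Matrix.one_mul, trace_smul, smul_eq_mul]

theorem normalisedTrace_comp_prepareOne (H : QSystem) :
    normalisedTrace H ≫ prepareOne H = depolariseProcess H := by
  refine hom_ext fun M => ?_
  change toLin (normalisedTrace H) M () () • (1 : Op H) = (M.trace / Fintype.card H.ι) • (1 : Op H)
  rw [toLin_normalisedTrace, div_eq_inv_mul]

theorem prepareOne_comp_normalisedTrace (H : QSystem) :
    prepareOne H ≫ normalisedTrace H = 𝟙 (𝟙_ QSystem) := by
  refine hom_ext fun M => ?_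
  ext ⟨⟩ ⟨⟩
  change toLin (normalisedTrace H) (M () () • (1 : Op H)) () () = M () ()
  rw [toLin_normalisedTrace, trace_smul, trace_one, smul_eq_mul, mul_comm, mul_assoc,
    mul_inv_cancel₀ (Nat.cast_ne_zero.mpr Fintype.card_ne_zero), mul_one]

/-- The map `σ ↦ 1 ⊗ σ` from operators of the outputs to operators of all wires. -/
def prep : ∀ A : Boxes QSystem, outs A ⟶ A.wires
  | .box H => (λ_ H).inv ≫ prepareOne H ▷ H
  | .tensor A B => prep A ⊗ₘ prep B

/-- The normalised partial trace over the inputs. -/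
noncomputable def extr : ∀ A : Boxes QSystem, A.wires ⟶ outs A
  | .box H => normalisedTrace H ▷ H ≫ (λ_ H).hom
  | .tensor A B => extr A ⊗ₘ extr B

/-- The process of `CP` underlying a process of `D(CP)`. -/
abbrev under {A B : Boxes QSystem} (f : A ⟶ B) : A.wires ⟶ B.wires := f

theorem prep_comp_extr : ∀ A : Boxes QSystem, prep A ≫ extr A = 𝟙 (outs A)
  | .box H => by
    change ((λ_ H).inv ≫ prepareOne H ▷ H) ≫ normalisedTrace H ▷ H ≫ (λ_ H).hom = 𝟙 H
    rw [Category.assoc, ← comp_whiskerRight_assoc, prepareOne_comp_normalisedTrace]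
    simp
  | .tensor A B => by
    change (prep A ⊗ₘ prep B) ≫ (extr A ⊗ₘ extr B) = 𝟙 (outs A ⊗ outs B)
    rw [tensorHom_comp_tensorHom, prep_comp_extr, prep_comp_extr, id_tensorHom_id]

theorem extr_comp_prep : ∀ A : Boxes QSystem, extr A ≫ prep A = under (hypdec A)
  | .box H => by
    change (normalisedTrace H ▷ H ≫ (λ_ H).hom) ≫ (λ_ H).inv ≫ prepareOne H ▷ H =
      depolariseProcess H ▷ H
    simp [← normalisedTrace_comp_prepareOne]
  | .tensor A B => by
    change (extr A ⊗ₘ extr B) ≫ (prep A ⊗ₘ prep B) = under (hypdec A) ⊗ₘ under (hypdec B)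
    rw [tensorHom_comp_tensorHom, extr_comp_prep, extr_comp_prep]

theorem toLin_tensorHom {X Y X' Y' : QSystem} (f : X ⟶ Y) (g : X' ⟶ Y') (M : Op (X ⊗ X'))
    (p q : Y.ι × Y'.ι) : toLin (f ⊗ₘ g) M p q = toLin g (Matrix.of fun x y =>
      toLin f (Matrix.of fun i j => M (i, x) (j, y)) p.1 q.1) p.2 q.2 := rfl

theorem toLin_tensorHom_kronecker {X Y X' Y' : QSystem} (f : X ⟶ Y) (g : X' ⟶ Y') (M : Op X)
    (N : Op X') : toLin (f ⊗ₘ g) (M ⊗ₖ N) = toLin f M ⊗ₖ toLin g N :=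
  (congrArg (tensorLeft _ (toLin g)) (tensorRight_kronecker (toLin f) M N)).trans
    (tensorLeft_kronecker _ _ _)

theorem toLin_prep (A : Boxes QSystem) (σ : Op (outs A)) (p q : A.wires.ι) :
    toLin (prep A) σ p q = (1 : Op (ins A)) (sortWires A p).1 (sortWires A q).1 *
      σ (sortWires A p).2 (sortWires A q).2 := by
  induction A with
  | box H => exact mul_comm _ _
  | tensor A B ihA ihB =>
    refine (toLin_tensorHom (prep A) (prep B) σ p q).trans ?_
    rw [ihB, of_apply, ihA, of_apply, ← mul_assoc]
    congr 1
    change _ = (1 : Matrix ((ins A).ι × (ins B).ι) ((ins A).ι × (ins B).ι) ℂ)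
      ((sortWires A p.1).1, (sortWires B p.2).1) ((sortWires A q.1).1, (sortWires B q.2).1)
    rw [← one_kronecker_one, kroneckerMap_apply, mul_comm]

theorem toLin_extr (A : Boxes QSystem) (M : Op A.wires) (x y : (outs A).ι) :
    toLin (extr A) M x y = (Fintype.card (ins A).ι : ℂ)⁻¹ *
      ∑ i, M ((sortWires A).symm (i, x)) ((sortWires A).symm (i, y)) := by
  induction A with
  | box H => exact toLin_normalisedTrace H _
  | tensor A B ihA ihB =>
    refine (toLin_tensorHom (extr A) (extr B) M x y).trans ?_
    rw [ihB]
    simp only [of_apply, ihA]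
    have hc : (Fintype.card (ins (A.tensor B)).ι : ℂ) =
        Fintype.card (ins A).ι * Fintype.card (ins B).ι := by
      rw [← Nat.cast_mul, ← Fintype.card_prod]
      rfl
    rw [hc, mul_inv, ← Finset.mul_sum, ← mul_assoc, mul_comm (Fintype.card (ins B).ι : ℂ)⁻¹]
    congr 1
    exact (Fintype.sum_prod_type_right (fun i : (ins A).ι × (ins B).ι =>
      M ((sortWires (A.tensor B)).symm (i, x)) ((sortWires (A.tensor B)).symm (i, y)))).symm

/-- The partial trace over the outputs. -/
def inMarginal (A : Boxes QSystem) (M : Op A.wires) : Op (ins A) :=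
  Matrix.of fun i j => ∑ x, M ((sortWires A).symm (i, x)) ((sortWires A).symm (j, x))

theorem trace_inMarginal (A : Boxes QSystem) (M : Op A.wires) :
    (inMarginal A M).trace = M.trace := by
  simp only [trace, diag_apply, inMarginal, of_apply]
  rw [← Fintype.sum_prod_type']
  exact Equiv.sum_comp (sortWires A).symm fun p => M p p

theorem trace_extr (A : Boxes QSystem) (M : Op A.wires) :
    (toLin (extr A) M).trace = (Fintype.card (ins A).ι : ℂ)⁻¹ * M.trace := by
  rw [← trace_inMarginal]
  simp only [trace, diag_apply, toLin_extr, inMarginal, of_apply]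
  rw [← Finset.mul_sum, Finset.sum_comm]

theorem inMarginal_kronecker {A B : Boxes QSystem} (M : Op A.wires) (N : Op B.wires) :
    inMarginal (A.tensor B) (M ⊗ₖ N) = inMarginal A M ⊗ₖ inMarginal B N := by
  ext i j
  refine (Fintype.sum_prod_type' (fun (x : (outs A).ι) (y : (outs B).ι) =>
    M ((sortWires A).symm (i.1, x)) ((sortWires A).symm (j.1, x)) *
      N ((sortWires B).symm (i.2, y)) ((sortWires B).symm (j.2, y)))).trans ?_
  exact (Finset.sum_mul_sum _ _ _ _).symm

/-! ### Process matrices and deterministic processes -/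

/-- Trace preservation of the local channels. -/
theorem inMarginal_of_mem_localChannels {A : Boxes QSystem} {M : Op A.wires}
    (hM : M ∈ localChannels A) : inMarginal A M = 1 := by
  induction A with
  | box H =>
    obtain ⟨f, hf, rfl⟩ := hM
    ext i j
    have h : (toLin f (single i j 1)).trace = (single i j (1 : ℂ)).trace := hf _
    refine h.trans ?_
    by_cases hij : i = j
    · subst hij
      simp
    · rw [trace_single_eq_of_ne _ _ _ hij, one_apply_ne hij]
  | tensor A B ihA ihB =>
    obtain ⟨M, hM, N, hN, rfl⟩ := hM
    rw [inMarginal_kronecker, ihA hM, ihB hN]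
    exact one_kronecker_one

/-- The process matrix which feeds the state `ρ` into the inputs and discards the outputs. -/
def inputEffect (A : Boxes QSystem) (ρ : Op (ins A)) (hρ : ρ.PosSemidef) :
    A ⟶ 𝟙_ (Boxes QSystem) :=
  ⟨traceWith ((ρ ⊗ₖ (1 : Op (outs A))).submatrix (sortWires A) (sortWires A)) (Unit × Unit),
    isCompletelyPositive_traceWith ((hρ.kronecker PosSemidef.one).submatrix _) _⟩

theorem boxLin_inputEffect (A : Boxes QSystem) {ρ : Op (ins A)} (hρ : ρ.PosSemidef)
    (M : Op A.wires) :
    boxLin (inputEffect A ρ hρ) M ((), ()) ((), ()) = (ρ * inMarginal A M).trace := by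
  change ((ρ ⊗ₖ (1 : Op (outs A))).submatrix (sortWires A) (sortWires A) * M).trace = _
  have h : M = (M.submatrix (sortWires A).symm (sortWires A).symm).submatrix
      (sortWires A) (sortWires A) := by
    ext
    simp
  conv_lhs => rw [h, submatrix_mul_equiv]
  change ∑ p, ((ρ ⊗ₖ (1 : Op (outs A))) * M.submatrix (sortWires A).symm (sortWires A).symm)
    (sortWires A p) (sortWires A p) = _
  rw [Equiv.sum_comp (sortWires A) fun p => ((ρ ⊗ₖ (1 : Op (outs A))) *
    M.submatrix (sortWires A).symm (sortWires A).symm) p p]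
  simp only [trace, diag_apply, mul_apply, inMarginal, of_apply, Fintype.sum_prod_type,
    kroneckerMap_apply, submatrix_apply, one_apply, Finset.mul_sum]
  refine Finset.sum_congr rfl fun i _ => ?_
  rw [Finset.sum_comm]
  refine Finset.sum_congr rfl fun j _ => ?_
  refine Finset.sum_congr rfl fun x _ => ?_
  simp

theorem inputEffect_mem (A : Boxes QSystem) {ρ : Op (ins A)} (hρ : ρ.PosSemidef)
    (htr : ρ.trace = 1) : inputEffect A ρ hρ ∈ processMatrices A := by
  intro M hM
  refine unit_ext ?_
  refine (boxLin_inputEffect A hρ M).trans ?_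
  rw [inMarginal_of_mem_localChannels hM, Matrix.mul_one, htr]
  exact (one_apply_eq _).symm

/-- The process matrix which feeds the maximally mixed state into the inputs and discards the
outputs. -/
noncomputable def mixedEffect (A : Boxes QSystem) : A ⟶ 𝟙_ (Boxes QSystem) :=
  inputEffect A ((Fintype.card (ins A).ι : ℂ)⁻¹ • 1)
    (PosSemidef.one.smul (inv_nonneg.mpr (Nat.cast_nonneg _)))

theorem boxLin_mixedEffect (A : Boxes QSystem) (M : Op A.wires) :
    boxLin (mixedEffect A) M ((), ()) ((), ()) = (Fintype.card (ins A).ι : ℂ)⁻¹ * M.trace := by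
  refine (boxLin_inputEffect A _ M).trans ?_
  rw [smul_mul_assoc, Matrix.one_mul, trace_smul, trace_inMarginal, smul_eq_mul]

theorem mixedEffect_mem (A : Boxes QSystem) : mixedEffect A ∈ processMatrices A :=
  inputEffect_mem A _ (by
    rw [trace_smul, trace_one, smul_eq_mul,
      inv_mul_cancel₀ (Nat.cast_ne_zero.mpr Fintype.card_ne_zero)])

theorem eq_mul_trace_of_kronecker {n k : Type} [Fintype n] [DecidableEq n] [Fintype k]
    [DecidableEq k] (φ : Matrix (n × k) (n × k) ℂ →ₗ[ℂ] ℂ) (c : ℂ)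
    (h : ∀ (σ : Matrix n n ℂ) (τ : Matrix k k ℂ), φ (σ ⊗ₖ τ) = c * σ.trace * τ.trace)
    (M : Matrix (n × k) (n × k) ℂ) : φ M = c * M.trace := by
  rw [matrix_eq_sum_single M]
  simp only [map_sum, trace_sum, Finset.mul_sum]
  refine Finset.sum_congr rfl fun p _ => Finset.sum_congr rfl fun q _ => ?_
  have e : single p q (M p q) = M p q • (single p.1 q.1 (1 : ℂ) ⊗ₖ single p.2 q.2 (1 : ℂ)) := by
    rw [single_kronecker_single, smul_single]
    simp
  rw [e, map_smul, trace_smul, trace_kronecker, smul_eq_mul, smul_eq_mul, h]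
  ring

/-- A linear functional which is constant on the families of local channels with constant output
is a multiple of the trace of that output: product density matrices span all operators. -/
theorem eq_mul_trace_of_prep_mem (A : Boxes QSystem) (φ : Op (outs A) →ₗ[ℂ] ℂ) (c : ℂ)
    (h : ∀ σ, toLin (prep A) σ ∈ localChannels A → φ σ = c) (σ : Op (outs A)) :
    φ σ = c * σ.trace := by
  induction A generalizing c with
  | box H =>
    refine eq_mul_trace_of_density φ c (fun ρ hρ htr => h ρ ?_) σ
    refine ⟨normalisedTrace H ≫ ⟨preparation () ((Fintype.card H.ι : ℂ) • ρ),
      isCompletelyPositive_preparation _ (hρ.smul (Nat.cast_nonneg _))⟩, fun M => ?_, ?_⟩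
    · change (toLin (normalisedTrace H) M () () • (Fintype.card H.ι : ℂ) • ρ).trace = _
      rw [toLin_normalisedTrace, smul_smul, trace_smul, htr, smul_eq_mul, mul_one, mul_right_comm,
        inv_mul_cancel₀ (Nat.cast_ne_zero.mpr Fintype.card_ne_zero), one_mul]
    · ext ⟨i, x⟩ ⟨j, y⟩
      refine (toLin_prep (.box H) ρ (i, x) (j, y)).trans ?_
      change _ = (toLin (normalisedTrace H) (single i j 1) () () •
        (Fintype.card H.ι : ℂ) • ρ) x y
      rw [toLin_normalisedTrace, smul_smul, mul_right_comm,
        inv_mul_cancel₀ (Nat.cast_ne_zero.mpr Fintype.card_ne_zero), one_mul]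
      change (1 : Op H) i j * ρ x y = (single i j (1 : ℂ)).trace * ρ x y
      congr 1
      by_cases hij : i = j
      · subst hij
        simp
      · rw [trace_single_eq_of_ne _ _ _ hij, one_apply_ne hij]
  | tensor A B ihA ihB =>
    have hk (σ : Op (outs A)) (τ : Op (outs B)) : φ (σ ⊗ₖ τ) = c * σ.trace * τ.trace := by
      refine ihB (φ ∘ₗ kroneckerBilinear (R := ℂ) σ) (c * σ.trace) (fun τ hτ => ?_) τ
      refine ihA (φ ∘ₗ (kroneckerBilinear (R := ℂ)).flip τ) c (fun σ hσ => ?_) σ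
      exact h _ ⟨_, hσ, _, hτ, toLin_tensorHom_kronecker _ _ _ _⟩
    exact eq_mul_trace_of_kronecker φ c hk σ

/-- A process matrix only depends on the trace of the output of boxes which ignore their input. -/
theorem boxLin_prep_kronecker {A L : Boxes QSystem} {W : A ⊗ L ⟶ 𝟙_ (Boxes QSystem)}
    (hW : W ∈ processMatrices (A ⊗ L)) {N : Op L.wires} (hN : N ∈ localChannels L)
    (σ : Op (outs A)) :
    boxLin W (toLin (prep A) σ ⊗ₖ N) ((), ()) ((), ()) = σ.trace := by
  have h := eq_mul_trace_of_prep_mem A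
    (entryLinearMap ℂ ℂ (((), ()) : Unit × Unit) (((), ()) : Unit × Unit) ∘ₗ boxLin W ∘ₗ
      (kroneckerBilinear (R := ℂ)).flip N ∘ₗ toLin (prep A)) 1
    (fun σ hσ => congrFun (congrFun (hW _ ⟨_, hσ, N, hN, rfl⟩) ((), ())) ((), ())) σ
  rwa [one_mul] at h

theorem boxLin_prep {A : Boxes QSystem} {W : A ⟶ 𝟙_ (Boxes QSystem)}
    (hW : W ∈ processMatrices A) (σ : Op (outs A)) :
    boxLin W (toLin (prep A) σ) ((), ()) ((), ()) = σ.trace := by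
  have h := eq_mul_trace_of_prep_mem A
    (entryLinearMap ℂ ℂ (((), ()) : Unit × Unit) (((), ()) : Unit × Unit) ∘ₗ boxLin W ∘ₗ
      toLin (prep A)) 1
    (fun σ hσ => congrFun (congrFun (hW _ hσ) ((), ())) ((), ())) σ
  rwa [one_mul] at h

theorem deterministic_iff {A B : Boxes QSystem} (f : A ⟶ B) :
    processEnvironment.deterministic f ↔ ∀ (L : Boxes QSystem) (W : B ⊗ L ⟶ 𝟙_ (Boxes QSystem)),
      W ∈ processMatrices (B ⊗ L) → ∀ M ∈ localChannels A, ∀ N ∈ localChannels L,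
        boxLin W (boxLin f M ⊗ₖ N) = 1 := by
  have key (L : Boxes QSystem) (W : B ⊗ L ⟶ 𝟙_ (Boxes QSystem)) (M : Op A.wires)
      (N : Op L.wires) : boxLin (f ▷ L ≫ W) (M ⊗ₖ N) = boxLin W (boxLin f M ⊗ₖ N) :=
    congrArg (boxLin W) (tensorRight_kronecker (boxLin f) M N)
  constructor
  · intro h L W hW M hM N hN
    rw [← key]
    exact h L W hW _ ⟨M, hM, N, hN, rfl⟩
  · rintro h L W hW _ ⟨M, hM, N, hN, rfl⟩
    exact (key L W M N).trans (h L W hW M hM N hN)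

theorem deterministic_of_mapsTo {A B : Boxes QSystem} {f : A ⟶ B}
    (h : ∀ M ∈ localChannels A, boxLin f M ∈ localChannels B) :
    processEnvironment.deterministic f :=
  (deterministic_iff f).mpr fun _ _ hW M hM N hN => hW _ ⟨_, h M hM, N, hN, rfl⟩

theorem comp_mem_processMatrices {A B : Boxes QSystem} {f : A ⟶ B}
    (hf : processEnvironment.deterministic f) {W : B ⟶ 𝟙_ (Boxes QSystem)}
    (hW : W ∈ processMatrices B) : f ≫ W ∈ processMatrices A := by
  have h : f ≫ W = (ρ_ A).inv ≫ f ▷ 𝟙_ (Boxes QSystem) ≫ (ρ_ B).hom ≫ W := by simp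
  rw [h]
  exact processEnvironment.symmetry_mem (.rightUnitor_inv A)
    (hf _ _ (processEnvironment.symmetry_mem (.rightUnitor_hom B) hW))

theorem trace_extr_of_mem_localChannels {A : Boxes QSystem} {M : Op A.wires}
    (hM : M ∈ localChannels A) : (toLin (extr A) M).trace = 1 := by
  rw [trace_extr, ← boxLin_mixedEffect, mixedEffect_mem A M hM]
  exact one_apply_eq _

/-- The process which forgets the inputs, acts on the outputs by `g` and ignores the new inputs. -/
noncomputable def outputProcess {A B : Boxes QSystem} (g : outs A ⟶ outs B) : A ⟶ B :=
  show A.wires ⟶ B.wires from extr A ≫ g ≫ prep B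

/-- Every channel between the outputs extends to a deterministic process which forgets the
inputs. -/
theorem deterministic_of_tracePreserving {A B : Boxes QSystem} {g : outs A ⟶ outs B}
    (hg : tracePreserving g) :
    processEnvironment.deterministic (outputProcess g) := by
  rw [deterministic_iff]
  intro L W hW M hM N hN
  refine unit_ext ((boxLin_prep_kronecker hW hN (toLin g (toLin (extr A) M))).trans ?_)
  rw [hg, trace_extr_of_mem_localChannels hM]
  exact (one_apply_eq _).symm

/-- A deterministic process induces a channel between the outputs. -/
theorem tracePreserving_of_deterministic {A B : Boxes QSystem} {f : A ⟶ B}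
    (hf : processEnvironment.deterministic f) :
    tracePreserving (prep A ≫ under f ≫ extr B) := by
  intro σ
  change (toLin (extr B) (boxLin f (toLin (prep A) σ))).trace = σ.trace
  rw [trace_extr, ← boxLin_mixedEffect]
  exact boxLin_prep (comp_mem_processMatrices hf (mixedEffect_mem B)) σ

theorem outputProcess_id (A : Boxes QSystem) : outputProcess (𝟙 (outs A)) = hypdec A := by
  change extr A ≫ 𝟙 (outs A) ≫ prep A = under (hypdec A)
  rw [Category.id_comp, extr_comp_prep]

theorem deterministic_hypdec (A : Boxes QSystem) : processEnvironment.deterministic (hypdec A) := by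
  rw [← outputProcess_id]
  exact deterministic_of_tracePreserving (tracePreserving.id_mem (outs A))

theorem noBackwardsSignalling_hypdec (A : Boxes QSystem) :
    processEnvironment.NoBackwardsSignalling (hypdec A) := by
  refine ⟨mixedEffect A, mixedEffect_mem A, fun W hW => ?_⟩
  refine hom_ext (X := A.wires) (Y := (𝟙_ (Boxes QSystem)).wires) fun M => unit_ext ?_
  change boxLin W (toLin (under (hypdec A)) M) ((), ()) ((), ()) = boxLin (mixedEffect A) M _ _
  rw [← extr_comp_prep]
  refine (boxLin_prep hW (toLin (extr A) M)).trans ?_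
  rw [trace_extr, boxLin_mixedEffect]

end Wires

/-! ### The equivalence of hyper-decohered boxes with channels -/

section Equivalence

theorem hypdec_idem (A : Boxes QSystem) : hypdec A ≫ hypdec A = hypdec A := by
  change under (hypdec A) ≫ under (hypdec A) = under (hypdec A)
  rw [← extr_comp_prep, Category.assoc, ← Category.assoc (prep A), prep_comp_extr,
    Category.id_comp]

theorem prepareOne_unit : prepareOne (𝟙_ QSystem) = 𝟙 (𝟙_ QSystem) :=
  hom_ext fun M => by
    ext ⟨⟩ ⟨⟩
    exact mul_one _

theorem normalisedTrace_unit : normalisedTrace (𝟙_ QSystem) = 𝟙 (𝟙_ QSystem) := by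
  have h := prepareOne_comp_normalisedTrace (𝟙_ QSystem)
  rwa [prepareOne_unit, Category.id_comp] at h

theorem prep_unit : prep (𝟙_ (Boxes QSystem)) = (λ_ (𝟙_ QSystem)).inv := by
  change (λ_ (𝟙_ QSystem)).inv ≫ prepareOne (𝟙_ QSystem) ▷ 𝟙_ QSystem = _
  rw [prepareOne_unit, id_whiskerRight, Category.comp_id]

theorem extr_unit : extr (𝟙_ (Boxes QSystem)) = (λ_ (𝟙_ QSystem)).hom := by
  change normalisedTrace (𝟙_ QSystem) ▷ 𝟙_ QSystem ≫ (λ_ (𝟙_ QSystem)).hom = _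
  rw [normalisedTrace_unit, id_whiskerRight, Category.id_comp]

theorem hypdec_unit : hypdec (𝟙_ (Boxes QSystem)) = 𝟙 (𝟙_ (Boxes QSystem)) := by
  refine (extr_comp_prep (𝟙_ (Boxes QSystem))).symm.trans ?_
  rw [extr_unit, prep_unit]
  exact Iso.hom_inv_id _

/-- The hyper-decoherence maps as idempotents of `QBox`. -/
noncomputable def hypdecFamily : IdempotentFamily QBox where
  map A := ⟨hypdec A.obj, deterministic_hypdec A.obj⟩
  idem A := WideSubcategory.hom_ext _ (hypdec_idem A.obj)
  map_unit := WideSubcategory.hom_ext _ hypdec_unit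
  map_tensor _ _ := rfl

/-- The boxes underlying a hyper-decohered system. -/
abbrev boxesOf (Y : hypdecFamily.Hyp) : Boxes QSystem := Y.obj.X.obj

/-- The completely positive map underlying a process of hyper-decohered systems. -/
abbrev cpOf {Y Z : hypdecFamily.Hyp} (f : Y ⟶ Z) : (boxesOf Y).wires ⟶ (boxesOf Z).wires :=
  f.hom.f.hom

theorem p_hom (Y : hypdecFamily.Hyp) : Y.obj.p.hom = hypdec (boxesOf Y) :=
  congrArg (fun g : Y.obj.X ⟶ Y.obj.X => g.hom) Y.property

theorem cpOf_comp_hypdec {Y Z : hypdecFamily.Hyp} (f : Y ⟶ Z) :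
    cpOf f ≫ under (hypdec (boxesOf Z)) = cpOf f := by
  have h := congrArg (fun g : Y.obj.X ⟶ Z.obj.X => g.hom) (Idempotents.Karoubi.comp_p f.hom)
  rwa [WideSubcategory.comp_def, p_hom] at h

theorem hypdec_comp_cpOf {Y Z : hypdecFamily.Hyp} (f : Y ⟶ Z) :
    under (hypdec (boxesOf Y)) ≫ cpOf f = cpOf f := by
  have h := congrArg (fun g : Y.obj.X ⟶ Z.obj.X => g.hom) (Idempotents.Karoubi.p_comp f.hom)
  rwa [WideSubcategory.comp_def, p_hom] at h

/-- The action of a process on the outputs, when the inputs are fed with noise. -/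
noncomputable def onOutputs {A B : Boxes QSystem} (f : A.wires ⟶ B.wires) : outs A ⟶ outs B :=
  prep A ≫ f ≫ extr B

theorem onOutputs_hypdec (A : Boxes QSystem) : onOutputs (under (hypdec A)) = 𝟙 (outs A) := by
  rw [onOutputs, ← extr_comp_prep, Category.assoc, prep_comp_extr, Category.comp_id,
    prep_comp_extr]

theorem onOutputs_hypdec_comp {A B : Boxes QSystem} (f : A.wires ⟶ B.wires) :
    onOutputs (under (hypdec A) ≫ f) = onOutputs f := by
  have h := prep_comp_extr A
  rw [onOutputs, onOutputs, ← extr_comp_prep, Category.assoc, Category.assoc, reassoc_of% h]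

theorem onOutputs_comp_hypdec {A B : Boxes QSystem} (f : A.wires ⟶ B.wires) :
    onOutputs (f ≫ under (hypdec B)) = onOutputs f := by
  rw [onOutputs, onOutputs, ← extr_comp_prep, Category.assoc, Category.assoc, prep_comp_extr,
    Category.comp_id]

/-- Interposing a hyper-decoherence map makes the action on the outputs functorial. -/
theorem onOutputs_comp_onOutputs {A B D : Boxes QSystem} (f : A.wires ⟶ B.wires)
    (g : B.wires ⟶ D.wires) :
    onOutputs f ≫ onOutputs g = onOutputs ((f ≫ under (hypdec B)) ≫ g) := by
  simp only [onOutputs, ← extr_comp_prep, Category.assoc]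

theorem onOutputs_tensorHom {A B A' B' : Boxes QSystem} (f : A.wires ⟶ B.wires)
    (g : A'.wires ⟶ B'.wires) :
    onOutputs (A := A.tensor A') (B := B.tensor B') (f ⊗ₘ g) = onOutputs f ⊗ₘ onOutputs g := by
  change (prep A ⊗ₘ prep A') ≫ (f ⊗ₘ g) ≫ (extr B ⊗ₘ extr B') = _
  simp only [onOutputs, tensorHom_comp_tensorHom]

theorem onOutputs_associator (A B D : Boxes QSystem) :
    onOutputs (A := (A.tensor B).tensor D) (B := A.tensor (B.tensor D))
      (α_ A.wires B.wires D.wires).hom = (α_ (outs A) (outs B) (outs D)).hom := by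
  change ((prep A ⊗ₘ prep B) ⊗ₘ prep D) ≫ (α_ A.wires B.wires D.wires).hom ≫
    (extr A ⊗ₘ (extr B ⊗ₘ extr D)) = _
  rw [associator_naturality_assoc]
  simp only [tensorHom_comp_tensorHom, prep_comp_extr, id_tensorHom_id, Category.comp_id]

theorem onOutputs_braiding (A B : Boxes QSystem) :
    onOutputs (A := A.tensor B) (B := B.tensor A) (β_ A.wires B.wires).hom =
      (β_ (outs A) (outs B)).hom := by
  change (prep A ⊗ₘ prep B) ≫ (β_ A.wires B.wires).hom ≫ (extr B ⊗ₘ extr A) = _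
  rw [BraidedCategory.braiding_naturality_assoc]
  simp only [tensorHom_comp_tensorHom, prep_comp_extr, id_tensorHom_id, Category.comp_id]

theorem onOutputs_leftUnitor (A : Boxes QSystem) :
    onOutputs (A := (𝟙_ (Boxes QSystem)).tensor A) (under (λ_ A).hom) = (λ_ (outs A)).hom := by
  have key {X Y : QSystem} (p : X ⟶ Y) (e : Y ⟶ X) (h : p ≫ e = 𝟙 X) :
      ((λ_ (𝟙_ QSystem)).inv ⊗ₘ p) ≫ ((λ_ (𝟙_ QSystem)).hom ▷ Y ≫ (λ_ Y).hom) ≫ e =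
        (λ_ X).hom := by
    rw [Category.assoc, ← tensorHom_id, tensorHom_comp_tensorHom_assoc, Iso.inv_hom_id,
      Category.comp_id, id_tensorHom, leftUnitor_naturality_assoc, h, Category.comp_id]
  refine Eq.trans ?_ (key _ _ (prep_comp_extr A))
  rw [← prep_unit]
  rfl

theorem onOutputs_rightUnitor (A : Boxes QSystem) :
    onOutputs (A := A.tensor (𝟙_ (Boxes QSystem))) (under (ρ_ A).hom) = (ρ_ (outs A)).hom := by
  have key {X Y : QSystem} (p : X ⟶ Y) (e : Y ⟶ X) (h : p ≫ e = 𝟙 X) :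
      (p ⊗ₘ (λ_ (𝟙_ QSystem)).inv) ≫ (Y ◁ (λ_ (𝟙_ QSystem)).hom ≫ (ρ_ Y).hom) ≫ e =
        (ρ_ X).hom := by
    rw [Category.assoc, ← id_tensorHom, tensorHom_comp_tensorHom_assoc, Iso.inv_hom_id,
      Category.comp_id, tensorHom_id, rightUnitor_naturality_assoc, h, Category.comp_id]
  refine Eq.trans ?_ (key _ _ (prep_comp_extr A))
  rw [← prep_unit]
  rfl

/-- The functor which sends a hyper-decohered system of boxes to its outputs. -/
noncomputable def outputFunctor : hypdecFamily.Hyp ⥤ CPTP where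
  obj Y := ⟨outs (boxesOf Y)⟩
  map f := ⟨onOutputs (cpOf f), tracePreserving_of_deterministic f.hom.f.property⟩
  map_id Y := by
    refine WideSubcategory.hom_ext _ ?_
    change onOutputs (A := boxesOf Y) (B := boxesOf Y) (under Y.obj.p.hom) = 𝟙 (outs (boxesOf Y))
    rw [p_hom, onOutputs_hypdec]
  map_comp {X Y Z} f g := by
    refine WideSubcategory.hom_ext _ ?_
    change onOutputs (cpOf f ≫ cpOf g) = onOutputs (cpOf f) ≫ onOutputs (cpOf g)
    rw [onOutputs_comp_onOutputs, cpOf_comp_hypdec]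

/-- The outputs of a parallel composition are the parallel composition of the outputs, on the
nose. -/
noncomputable def outputFunctorCoreMonoidal : outputFunctor.CoreMonoidal where
  εIso := Iso.refl (𝟙_ CPTP)
  μIso Y Z := Iso.refl (outputFunctor.obj Y ⊗ outputFunctor.obj Z)
  μIso_hom_natural_left {Y Z} f X := by
    refine WideSubcategory.hom_ext _ ?_
    change onOutputs (cpOf f) ▷ outs (boxesOf X) ≫ 𝟙 _ = 𝟙 _ ≫
      onOutputs (A := (boxesOf Y).tensor (boxesOf X)) (B := (boxesOf Z).tensor (boxesOf X))
        (cpOf f ⊗ₘ under X.obj.p.hom)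
    rw [Category.comp_id, Category.id_comp, onOutputs_tensorHom, p_hom, onOutputs_hypdec,
      tensorHom_id]
  μIso_hom_natural_right {Y Z} X f := by
    refine WideSubcategory.hom_ext _ ?_
    change outs (boxesOf X) ◁ onOutputs (cpOf f) ≫ 𝟙 _ = 𝟙 _ ≫
      onOutputs (A := (boxesOf X).tensor (boxesOf Y)) (B := (boxesOf X).tensor (boxesOf Z))
        (under X.obj.p.hom ⊗ₘ cpOf f)
    rw [Category.comp_id, Category.id_comp, onOutputs_tensorHom, p_hom, onOutputs_hypdec,
      id_tensorHom]
  associativity X Y Z := by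
    refine WideSubcategory.hom_ext _ ?_
    change 𝟙 _ ▷ outs (boxesOf Z) ≫ 𝟙 _ ≫
      onOutputs (A := ((boxesOf X).tensor (boxesOf Y)).tensor (boxesOf Z))
        (B := (boxesOf X).tensor ((boxesOf Y).tensor (boxesOf Z)))
        (((under X.obj.p.hom ⊗ₘ under Y.obj.p.hom) ⊗ₘ under Z.obj.p.hom) ≫
          (α_ (boxesOf X).wires (boxesOf Y).wires (boxesOf Z).wires).hom) =
      (α_ (outs (boxesOf X)) (outs (boxesOf Y)) (outs (boxesOf Z))).hom ≫
        outs (boxesOf X) ◁ 𝟙 _ ≫ 𝟙 _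
    rw [p_hom, p_hom, p_hom, id_whiskerRight, whiskerLeft_id, Category.id_comp, Category.id_comp,
      Category.comp_id]
    refine (Category.id_comp _).trans (Eq.trans ?_ (onOutputs_associator _ _ _))
    exact onOutputs_hypdec_comp (A := ((boxesOf X).tensor (boxesOf Y)).tensor (boxesOf Z))
      (B := (boxesOf X).tensor ((boxesOf Y).tensor (boxesOf Z))) _
  left_unitality X := by
    refine WideSubcategory.hom_ext _ ?_
    change (λ_ (outs (boxesOf X))).hom =
      onOutputs (A := (𝟙_ (Boxes QSystem)).tensor (boxesOf X)) (B := boxesOf X)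
        ((𝟙 (𝟙_ (Boxes QSystem)).wires ⊗ₘ under X.obj.p.hom) ≫ under (λ_ (boxesOf X)).hom)
    rw [p_hom, ← onOutputs_leftUnitor, ← onOutputs_hypdec_comp]
    congr 2
    change under (hypdec (𝟙_ (Boxes QSystem))) ⊗ₘ under (hypdec (boxesOf X)) = _
    rw [hypdec_unit]
    rfl
  right_unitality X := by
    refine WideSubcategory.hom_ext _ ?_
    change (ρ_ (outs (boxesOf X))).hom =
      onOutputs (A := (boxesOf X).tensor (𝟙_ (Boxes QSystem))) (B := boxesOf X)
        ((under X.obj.p.hom ⊗ₘ 𝟙 (𝟙_ (Boxes QSystem)).wires) ≫ under (ρ_ (boxesOf X)).hom)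
    rw [p_hom, ← onOutputs_rightUnitor, ← onOutputs_hypdec_comp]
    congr 2
    change under (hypdec (boxesOf X)) ⊗ₘ under (hypdec (𝟙_ (Boxes QSystem))) = _
    rw [hypdec_unit]
    rfl

noncomputable instance : outputFunctor.Monoidal := outputFunctorCoreMonoidal.toMonoidal

noncomputable instance : outputFunctor.Braided where
  braided Y Z := by
    refine WideSubcategory.hom_ext _ ?_
    change 𝟙 _ ≫ onOutputs (A := (boxesOf Y).tensor (boxesOf Z))
      (B := (boxesOf Z).tensor (boxesOf Y)) ((under Y.obj.p.hom ⊗ₘ under Z.obj.p.hom) ≫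
        (β_ (boxesOf Y).wires (boxesOf Z).wires).hom) =
      (β_ (outs (boxesOf Y)) (outs (boxesOf Z))).hom ≫ 𝟙 _
    rw [p_hom, p_hom, Category.id_comp, Category.comp_id, ← onOutputs_braiding]
    exact onOutputs_hypdec_comp (A := (boxesOf Y).tensor (boxesOf Z))
      (B := (boxesOf Z).tensor (boxesOf Y)) _

theorem extr_onOutputs_prep {Y Z : hypdecFamily.Hyp} (f : Y ⟶ Z) :
    extr (boxesOf Y) ≫ onOutputs (cpOf f) ≫ prep (boxesOf Z) = cpOf f := by
  have h := extr_comp_prep (boxesOf Y)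
  rw [onOutputs, Category.assoc, Category.assoc, extr_comp_prep, reassoc_of% h, cpOf_comp_hypdec,
    hypdec_comp_cpOf]

instance : outputFunctor.Faithful where
  map_injective {Y Z} f g hfg := by
    have h : onOutputs (cpOf f) = onOutputs (cpOf g) :=
      congrArg (fun k : outputFunctor.obj Y ⟶ outputFunctor.obj Z => k.hom) hfg
    refine ObjectProperty.hom_ext _ (Idempotents.Karoubi.Hom.ext (WideSubcategory.hom_ext _ ?_))
    change cpOf f = cpOf g
    rw [← extr_onOutputs_prep f, h, extr_onOutputs_prep]

instance : outputFunctor.Full where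
  map_surjective {Y Z} := by
    rintro ⟨g, hg⟩
    change outs (boxesOf Y) ⟶ outs (boxesOf Z) at g
    have h₁ := prep_comp_extr (boxesOf Y)
    have h₂ := prep_comp_extr (boxesOf Z)
    refine ⟨ObjectProperty.homMk ⟨⟨outputProcess g,
      deterministic_of_tracePreserving hg⟩, WideSubcategory.hom_ext _ ?_⟩,
      WideSubcategory.hom_ext _ ?_⟩
    · change under Y.obj.p.hom ≫ (extr (boxesOf Y) ≫ g ≫ prep (boxesOf Z)) ≫
        under Z.obj.p.hom = extr (boxesOf Y) ≫ g ≫ prep (boxesOf Z)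
      rw [p_hom, p_hom, ← extr_comp_prep, ← extr_comp_prep]
      simp only [Category.assoc]
      rw [reassoc_of% h₁, reassoc_of% h₂]
    · change prep (boxesOf Y) ≫ (extr (boxesOf Y) ≫ g ≫ prep (boxesOf Z)) ≫
        extr (boxesOf Z) = g
      simp only [Category.assoc]
      rw [reassoc_of% h₁, h₂, Category.comp_id]

instance : outputFunctor.EssSurj where
  mem_essImage H := ⟨hypdecFamily.split ⟨.box H.obj⟩, ⟨Iso.refl H⟩⟩

theorem outputFunctor_map_mixture {Y Z : hypdecFamily.Hyp} (f g k : Y ⟶ Z) (a b : ℝ≥0)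
    (h : k.hom.f.hom = a • f.hom.f.hom + b • g.hom.f.hom) :
    (outputFunctor.map k).hom = a • (outputFunctor.map f).hom + b • (outputFunctor.map g).hom := by
  refine hom_ext fun M => ?_
  have hk (N) : toLin (cpOf k) N = a • toLin (cpOf f) N + b • toLin (cpOf g) N :=
    congrArg (fun l : (boxesOf Y).wires ⟶ (boxesOf Z).wires => toLin l N) h
  have hr (r : ℝ≥0) (N : Op (boxesOf Z).wires) :
      toLin (extr (boxesOf Z)) (r • N) = r • toLin (extr (boxesOf Z)) N :=
    (toLin (extr (boxesOf Z))).map_smul_of_tower r N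
  change toLin (extr _) (toLin (cpOf k) (toLin (prep _) M)) =
    a • toLin (extr _) (toLin (cpOf f) (toLin (prep _) M)) +
    b • toLin (extr _) (toLin (cpOf g) (toLin (prep _) M))
  rw [hk, map_add, hr, hr]

end Equivalence

/-! ### States -/

section States

open Matrix

/-- A state of a quantum system is determined by its density matrix. -/
theorem toLin_state {H : QSystem} (f : 𝟙_ QSystem ⟶ H) (M : Op (𝟙_ QSystem)) :
    toLin f M = M () () • toLin f 1 := by
  rw [← map_smul]
  congr 1
  ext ⟨⟩ ⟨⟩
  exact (mul_one _).symm

theorem state_ext {H : QSystem} {f g : 𝟙_ QSystem ⟶ H} (h : toLin f 1 = toLin g 1) : f = g :=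
  hom_ext fun M => by rw [toLin_state f, toLin_state g, h]

theorem boxLin_state {A : Boxes QSystem} (f : 𝟙_ (Boxes QSystem) ⟶ A)
    (M : Op (𝟙_ (Boxes QSystem)).wires) : boxLin f M = M ((), ()) ((), ()) • boxLin f 1 := by
  rw [← map_smul]
  congr 1
  exact unit_ext (mul_one _).symm

theorem boxState_ext {A : Boxes QSystem} {f g : 𝟙_ (Boxes QSystem) ⟶ A}
    (h : boxLin f 1 = boxLin g 1) : f = g :=
  hom_ext (X := (𝟙_ (Boxes QSystem)).wires) (Y := A.wires) fun M =>
    (boxLin_state f M).trans ((congrArg _ h).trans (boxLin_state g M).symm)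

/-- The state of a quantum system with a given density matrix. -/
def channelState (H : CPTP) (ρ : Op H.obj) (hρ : ρ.PosSemidef) (htr : ρ.trace = 1) :
    𝟙_ CPTP ⟶ H :=
  ⟨⟨preparation () ρ, isCompletelyPositive_preparation () hρ⟩, fun M => by
    change (M () () • ρ).trace = ∑ i : Unit, M i i
    rw [trace_smul, htr, smul_eq_mul, mul_one, Fintype.sum_unique]⟩

theorem toLin_channelState (H : CPTP) {ρ : Op H.obj} (hρ : ρ.PosSemidef) (htr : ρ.trace = 1) :
    toLin (channelState H ρ hρ htr).hom 1 = ρ :=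
  one_smul ℂ ρ

theorem posSemidef_state {H : CPTP} (s : 𝟙_ CPTP ⟶ H) : (toLin s.hom 1).PosSemidef :=
  s.hom.2.posSemidef PosSemidef.one

theorem trace_state {H : CPTP} (s : 𝟙_ CPTP ⟶ H) : (toLin s.hom 1).trace = 1 :=
  (s.property 1).trans (trace_one.trans (by simp [MonoidalCategoryStruct.tensorUnit]))

/-- The operator of a state of `QBox`. -/
noncomputable abbrev boxOp {A : QBox} (s : 𝟙_ QBox ⟶ A) : Op A.obj.wires :=
  boxLin (A := 𝟙_ (Boxes QSystem)) (B := A.obj) s.hom 1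

theorem deterministic_state_iff {A : Boxes QSystem} (f : 𝟙_ (Boxes QSystem) ⟶ A) :
    processEnvironment.deterministic f ↔ ∀ (L : Boxes QSystem) (W : A ⊗ L ⟶ 𝟙_ (Boxes QSystem)),
      W ∈ processMatrices (A ⊗ L) → ∀ N ∈ localChannels L, boxLin W (boxLin f 1 ⊗ₖ N) = 1 := by
  rw [deterministic_iff, localChannels_unit]
  simp only [Set.mem_singleton_iff, forall_eq]

/-- The state of `QBox` with a given operator. -/
def boxState (A : QBox) (M : Op A.obj.wires) (hM : M.PosSemidef)
    (hdet : ∀ (L : Boxes QSystem) (W : A.obj ⊗ L ⟶ 𝟙_ (Boxes QSystem)),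
      W ∈ processMatrices (A.obj ⊗ L) → ∀ N ∈ localChannels L, boxLin W (M ⊗ₖ N) = 1) :
    𝟙_ QBox ⟶ A :=
  ⟨⟨preparation ((), ()) M, isCompletelyPositive_preparation _ hM⟩,
    (deterministic_state_iff _).mpr fun L W hW N hN => by
      refine Eq.trans ?_ (hdet L W hW N hN)
      exact congrArg (fun K : Op A.obj.wires => boxLin W (K ⊗ₖ N)) (one_smul ℂ M)⟩

theorem boxOp_boxState (A : QBox) {M : Op A.obj.wires} (hM : M.PosSemidef)
    (hdet : ∀ (L : Boxes QSystem) (W : A.obj ⊗ L ⟶ 𝟙_ (Boxes QSystem)),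
      W ∈ processMatrices (A.obj ⊗ L) → ∀ N ∈ localChannels L, boxLin W (M ⊗ₖ N) = 1) :
    boxOp (boxState A M hM hdet) = M :=
  one_smul ℂ M

theorem posSemidef_boxOp {A : QBox} (s : 𝟙_ QBox ⟶ A) : (boxOp s).PosSemidef :=
  s.hom.2.posSemidef PosSemidef.one

theorem boxLin_boxOp {A : QBox} (s : 𝟙_ QBox ⟶ A) {W : A.obj ⟶ 𝟙_ (Boxes QSystem)}
    (hW : W ∈ processMatrices A.obj) : boxLin W (boxOp s) = 1 :=
  comp_mem_processMatrices s.property hW 1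
    (localChannels_unit.symm ▸ Set.mem_singleton _)

/-- A deterministic state does not signal from its outputs to its inputs. -/
theorem inMarginal_boxOp {A : QBox} (s : 𝟙_ QBox ⟶ A) : inMarginal A.obj (boxOp s) = 1 := by
  have h (ρ : Op (ins A.obj)) : (ρ * inMarginal A.obj (boxOp s)).trace = 1 * ρ.trace :=
    eq_mul_trace_of_density
      (traceLinearMap _ ℂ ℂ ∘ₗ LinearMap.mulRight ℂ (inMarginal A.obj (boxOp s))) 1
      (fun ρ hρ htr => by
        refine (boxLin_inputEffect A.obj hρ (boxOp s)).symm.trans ?_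
        rw [boxLin_boxOp s (inputEffect_mem A.obj hρ htr)]
        exact one_apply_eq _) ρ
  ext i j
  have hij := h (single j i 1)
  rw [one_mul, trace_single_mul, one_smul] at hij
  rw [hij]
  by_cases e : i = j
  · subst e
    simp
  · rw [trace_single_eq_of_ne _ _ _ (Ne.symm e), one_apply_ne e]

/-- The state of `CPTP` to which a state of `QBox` hyper-decoheres. -/
noncomputable abbrev outState {A : QBox} (s : 𝟙_ QBox ⟶ A) : 𝟙_ CPTP ⟶ ⟨outs A.obj⟩ :=
  Functor.LaxMonoidal.ε outputFunctor ≫ outputFunctor.map (hypdecFamily.splitState s)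

theorem toLin_outState {A : QBox} (s : 𝟙_ QBox ⟶ A) :
    toLin (outState s).hom 1 = toLin (extr A.obj) (boxOp s) := by
  have h : (outState s).hom = prep (𝟙_ (Boxes QSystem)) ≫ under s.hom ≫ extr A.obj :=
    onOutputs_comp_hypdec (A := 𝟙_ (Boxes QSystem)) (B := A.obj) s.hom
  rw [h, prep_unit]
  change toLin (extr A.obj) (boxLin s.hom _) = _
  congr 2

/-! ### Purity -/

/-- The density matrix of a pure quantum state has rank one. -/
theorem IsPure.exists_vecMulVec {H : CPTP} {s : 𝟙_ CPTP ⟶ H} (hs : IsPure s) :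
    ∃ v : H.obj.ι → ℂ, toLin s.hom 1 = vecMulVec v (star v) ∧ v ⬝ᵥ star v = 1 := by
  refine exists_vecMulVec_of_extreme (posSemidef_state s) (trace_state s)
    fun σ τ hσ hσ' hτ hτ' a b ha hb hab h => ?_
  have key := hs.2 ⟨channelState H σ hσ hσ', rfl⟩ ⟨channelState H τ hτ hτ', rfl⟩
    ⟨⟨a, ha.le⟩, ⟨b, hb.le⟩, ha, hb, NNReal.eq hab, state_ext ?_⟩
  · rw [← key, toLin_channelState]
  · refine Eq.trans ?_ h
    exact congrArg₂ (fun X Y : Op H.obj => a • X + b • Y) (toLin_channelState H hσ hσ')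
      (toLin_channelState H hτ hτ')

/-- A state of `QBox` which hyper-decoheres to a rank one state is determined by the latter. -/
theorem boxOp_eq_of_outState {A : QBox} (s : 𝟙_ QBox ⟶ A) {v : (outs A.obj).ι → ℂ}
    (hv : v ⬝ᵥ star v = 1) (h : toLin (extr A.obj) (boxOp s) = vecMulVec v (star v)) :
    boxOp s = ((1 : Op (ins A.obj)) ⊗ₖ vecMulVec v (star v)).submatrix (sortWires A.obj)
      (sortWires A.obj) := by
  have key := eq_of_marginals
    (M := (boxOp s).submatrix (sortWires A.obj).symm (sortWires A.obj).symm)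
    (c := Fintype.card (ins A.obj).ι) ((posSemidef_boxOp s).submatrix _) hv (fun x y => ?_)
    fun i j => congrFun (congrFun (inMarginal_boxOp s) i) j
  · rw [← key]
    ext
    simp
  · have hxy := congrFun (congrFun h x) y
    rw [toLin_extr, inv_mul_eq_iff_eq_mul₀ (Nat.cast_ne_zero.mpr Fintype.card_ne_zero)] at hxy
    exact hxy

theorem isPure_of_isPure_outState {A : QBox} (s : 𝟙_ QBox ⟶ A) (hs : IsPure (outState s)) :
    IsPure s := by
  obtain ⟨v, hsv, hv⟩ := hs.exists_vecMulVec
  refine ⟨⟨s, rfl⟩, ?_⟩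
  rintro _ ⟨t, rfl⟩ _ ⟨u, rfl⟩ ⟨a, b, ha, hb, hab, h⟩
  have h' : a • boxOp t + b • boxOp u = boxOp s :=
    congrArg (fun f : 𝟙_ (Boxes QSystem) ⟶ A.obj => boxLin f 1) h
  have hr (r : ℝ≥0) (N : Op A.obj.wires) :
      toLin (extr A.obj) (r • N) = r • toLin (extr A.obj) N :=
    (toLin (extr A.obj)).map_smul_of_tower r N
  have ht : (outState t).hom = (outState s).hom := by
    refine hs.2 ⟨outState t, rfl⟩ ⟨outState u, rfl⟩ ⟨a, b, ha, hb, hab, state_ext ?_⟩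
    change a • toLin (outState t).hom 1 + b • toLin (outState u).hom 1 = _
    rw [toLin_outState, toLin_outState, toLin_outState, ← h', map_add, hr, hr]
  refine boxState_ext (A := A.obj) ?_
  refine (boxOp_eq_of_outState t hv ?_).trans (boxOp_eq_of_outState s hv ?_).symm
  · rw [← toLin_outState, ht, hsv]
  · rw [← toLin_outState, hsv]

end States

/-! ### Maximally mixed states -/

section MaximallyMixed

open Matrix

/-- Every positive operator occurs in a decomposition of a positive multiple of the identity. -/
theorem exists_mixture_eq_smul_one {n : Type} [Fintype n] [DecidableEq n] {t : Matrix n n ℂ}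
    (ht : t.PosSemidef) {c : ℝ} (hc : 0 < c) :
    ∃ (a b : ℝ≥0) (u : Matrix n n ℂ), 0 < a ∧ 0 < b ∧ a + b = 1 ∧ u.PosSemidef ∧
      a • t + b • u = c • (1 : Matrix n n ℂ) := by
  obtain ⟨a, ha, ha1, h⟩ := exists_pos_smul_one_sub ht hc
  have hb : 0 < 1 - a := sub_pos.mpr ha1
  refine ⟨⟨a, ha.le⟩, ⟨1 - a, hb.le⟩, (1 - a)⁻¹ • (c • (1 : Matrix n n ℂ) - a • t), ha, hb,
    NNReal.eq (add_sub_cancel a 1), h.smul (inv_nonneg.mpr hb.le), ?_⟩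
  change a • t + (1 - a) • (1 - a)⁻¹ • (c • (1 : Matrix n n ℂ) - a • t) = _
  rw [smul_smul, mul_inv_cancel₀ hb.ne', one_smul, add_sub_cancel]

/-- If two complex numbers mix to `1` and the first one is `1`, so is the second one. -/
theorem eq_one_of_mixture {a b : ℝ≥0} (hb : 0 < b) (hab : a + b = 1) {z : ℂ}
    (h : a • (1 : ℂ) + b • z = 1) : z = 1 := by
  have hab' : (a : ℂ) + b = 1 := by exact_mod_cast congrArg NNReal.toReal hab
  have hb' : (b : ℂ) ≠ 0 := by exact_mod_cast hb.ne'
  have h' : (a : ℂ) * 1 + b * z = 1 := h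
  exact mul_left_cancel₀ hb' (by linear_combination h' - hab')

/-- The state proportional to the identity is maximally mixed among the density matrices. -/
theorem isMaximallyMixed_of_toLin_eq {H : CPTP} (s : 𝟙_ CPTP ⟶ H) {c : ℝ} (hc : 0 < c)
    (hs : toLin s.hom 1 = c • (1 : Op H.obj)) : IsMaximallyMixed s := by
  refine ⟨fun t => ?_, fun T => WideSubcategory.hom_ext _ (state_ext ?_)⟩
  · obtain ⟨a, b, u, ha, hb, hab, hu, h⟩ := exists_mixture_eq_smul_one (posSemidef_state t) hc
    have hu1 : u.trace = 1 := by
      refine eq_one_of_mixture hb hab ?_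
      rw [← trace_state t, ← trace_smul, ← trace_smul, ← trace_add, h, ← hs, trace_state,
        trace_state]
    refine ⟨channelState H u hu hu1, a, b, ha, hb, hab, state_ext ?_⟩
    rw [hs, ← h]
    exact congrArg (fun X : Op H.obj => a • toLin t.hom 1 + b • X) (toLin_channelState H hu hu1)
  · have hT : toLin T.hom.hom 1 = 1 :=
      IsCompletelyPositive.map_one_of_inverse T.hom.hom.2 T.inv.hom.2
        (fun M => congrArg (fun f : H ⟶ H => toLin f.hom M) T.hom_inv_id)
        (T.hom.property 1) (T.inv.property 1)
    change toLin T.hom.hom (toLin s.hom 1) = toLin s.hom 1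
    rw [hs]
    exact ((toLin T.hom.hom).map_smul_of_tower c 1).trans (congrArg _ hT)

/-- The completely depolarising channels form a family of local channels. -/
theorem exists_smul_one_mem_localChannels (A : Boxes QSystem) :
    ∃ c : ℝ, 0 < c ∧ c • (1 : Op A.wires) ∈ localChannels A := by
  induction A with
  | box H =>
    have hd : (Fintype.card H.ι : ℂ) ≠ 0 := Nat.cast_ne_zero.mpr Fintype.card_ne_zero
    refine ⟨(Fintype.card H.ι : ℝ)⁻¹, by positivity, depolariseProcess H, fun M => ?_, ?_⟩
    · change ((M.trace / Fintype.card H.ι) • (1 : Op H)).trace = M.trace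
      rw [trace_smul, trace_one, smul_eq_mul, div_mul_cancel₀ _ hd]
    · change (Fintype.card H.ι : ℝ)⁻¹ • (1 : Matrix (H.ι × H.ι) (H.ι × H.ι) ℂ) = _
      ext ⟨i, x⟩ ⟨j, y⟩
      change _ = ((single i j (1 : ℂ)).trace / Fintype.card H.ι) * (1 : Op H) x y
      rw [← one_kronecker_one]
      simp only [Matrix.smul_apply, kroneckerMap_apply, Complex.real_smul]
      by_cases hij : i = j
      · subst hij
        simp
      · rw [trace_single_eq_of_ne _ _ _ hij, one_apply_ne hij]
        simp
  | tensor A B ihA ihB =>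
    obtain ⟨c, hc, hA⟩ := ihA
    obtain ⟨d, hd, hB⟩ := ihB
    refine ⟨c * d, mul_pos hc hd, _, hA, _, hB, ?_⟩
    change (c * d) • (1 : Matrix (A.wires.ι × B.wires.ι) (A.wires.ι × B.wires.ι) ℂ) = _
    rw [smul_kronecker, kronecker_smul, one_kronecker_one, smul_smul]

/-- Deterministic processes preserve the trace on local channels, among them a multiple of `1`. -/
theorem trace_boxLin_of_deterministic {A : Boxes QSystem} {f : A ⟶ A}
    (hf : processEnvironment.deterministic f) : (boxLin f 1).trace = (1 : Op A.wires).trace := by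
  obtain ⟨c, hc, hA⟩ := exists_smul_one_mem_localChannels A
  have h₁ : boxLin (mixedEffect A) (boxLin f (c • 1)) = 1 :=
    comp_mem_processMatrices hf (mixedEffect_mem A) _ hA
  have h₂ : boxLin (mixedEffect A) (c • 1) = 1 := mixedEffect_mem A _ hA
  have h₃ := congrFun (congrFun (h₁.trans h₂.symm) ((), ())) ((), ())
  have e : boxLin f (c • 1) = c • boxLin f 1 := (boxLin f).map_smul_of_tower c 1
  rw [boxLin_mixedEffect, boxLin_mixedEffect, e, trace_smul, trace_smul] at h₃
  have hd : (Fintype.card (ins A).ι : ℂ)⁻¹ ≠ 0 :=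
    inv_ne_zero (Nat.cast_ne_zero.mpr Fintype.card_ne_zero)
  exact smul_right_injective ℂ hc.ne' (mul_left_cancel₀ hd h₃)

/-- The family of completely depolarising channels is a maximally mixed state of boxes. -/
theorem exists_isMaximallyMixed (A : QBox) : ∃ s : 𝟙_ QBox ⟶ A, IsMaximallyMixed s := by
  obtain ⟨c, hc, hA⟩ := exists_smul_one_mem_localChannels A.obj
  have hpos : (c • (1 : Op A.obj.wires)).PosSemidef := PosSemidef.one.smul hc.le
  have hdet (L : Boxes QSystem) (W : A.obj ⊗ L ⟶ 𝟙_ (Boxes QSystem))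
      (hW : W ∈ processMatrices (A.obj ⊗ L)) (N : Op L.wires) (hN : N ∈ localChannels L) :
      boxLin W ((c • (1 : Op A.obj.wires)) ⊗ₖ N) = 1 := hW _ ⟨_, hA, N, hN, rfl⟩
  refine ⟨boxState A _ hpos hdet, fun t => ?_, fun T => WideSubcategory.hom_ext _
    (boxState_ext (A := A.obj) ?_)⟩
  · obtain ⟨a, b, u, ha, hb, hab, hu, h⟩ := exists_mixture_eq_smul_one (posSemidef_boxOp t) hc
    refine ⟨boxState A u hu fun L W hW N hN => unit_ext ?_, a, b, ha, hb, hab,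
      boxState_ext (A := A.obj) ?_⟩
    · refine (eq_one_of_mixture hb hab ?_).trans (one_apply_eq _).symm
      have ht := (deterministic_state_iff _).mp t.property L W hW N hN
      have hm := hdet L W hW N hN
      have hW' : boxLin W ((a • boxOp t + b • u) ⊗ₖ N) =
          a • boxLin W (boxOp t ⊗ₖ N) + b • boxLin W (u ⊗ₖ N) := by
        rw [add_kronecker, smul_kronecker, smul_kronecker]
        exact (map_add (boxLin W) _ _).trans (congrArg₂ (· + ·)
          ((boxLin W).map_smul_of_tower a _) ((boxLin W).map_smul_of_tower b _))
      rw [h, hm] at hW'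
      have h1 := congrFun (congrFun hW' ((), ())) ((), ())
      have h2 := congrFun (congrFun ht ((), ())) ((), ())
      have e : (1 : Op (𝟙_ (Boxes QSystem)).wires) ((), ()) ((), ()) = 1 := one_apply_eq _
      rw [e] at h1 h2
      refine Eq.trans ?_ h1.symm
      exact congrArg (fun z : ℂ => a • z + b • boxLin W (u ⊗ₖ N) ((), ()) ((), ())) h2.symm
    · refine Eq.trans ?_ (boxOp_boxState A hpos hdet).symm
      refine Eq.trans ?_ h
      exact congrArg (fun X : Op A.obj.wires => a • boxOp t + b • X) (one_smul ℂ u)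
  · have hT : boxLin (A := A.obj) (B := A.obj) T.hom.hom 1 = 1 :=
      IsCompletelyPositive.map_one_of_inverse T.hom.hom.2 T.inv.hom.2
        (fun M => congrArg (fun f : A ⟶ A => boxLin (A := A.obj) (B := A.obj) f.hom M)
          T.hom_inv_id)
        (trace_boxLin_of_deterministic T.hom.property)
        (trace_boxLin_of_deterministic T.inv.property)
    change boxLin (A := A.obj) (B := A.obj) T.hom.hom (boxOp (boxState A _ hpos hdet)) =
      boxOp (boxState A _ hpos hdet)
    rw [boxOp_boxState A hpos hdet]
    exact ((boxLin (A := A.obj) (B := A.obj) T.hom.hom).map_smul_of_tower c 1).trans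
      (congrArg _ hT)

/-! ### Symmetries of the outputs -/

/-- An operator which is invariant under all invertible channels is a multiple of the identity:
the sign flips kill the off-diagonal entries, and the transpositions identify the diagonal ones. -/
theorem depolarise_eq_self {H : QSystem} {N : Op H}
    (hN : ∀ T : (⟨H⟩ : CPTP) ≅ ⟨H⟩, toLin (X := H) (Y := H) T.hom.hom N = N) :
    toLin (depolariseProcess H) N = N := by
  have hoff {i j : H.ι} (hij : i ≠ j) : N i j = 0 := by
    let D : Op H := diagonal fun k => if k = i then -1 else 1
    have hD : D * D = 1 := by
      rw [diagonal_mul_diagonal, ← diagonal_one]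
      congr 1
      funext k
      split_ifs <;> simp
    have hDH : Dᴴ = D := by
      rw [diagonal_conjTranspose]
      congr 1
      funext k
      simp only [Pi.star_apply]
      split_ifs <;> simp
    let f : H ⟶ H := ⟨conjBy D, isCompletelyPositive_conjBy D⟩
    have hff : f ≫ f = 𝟙 H := hom_ext fun M => by
      change D * (D * M * Dᴴ) * Dᴴ = M
      rw [hDH, Matrix.mul_assoc, Matrix.mul_assoc, Matrix.mul_assoc, hD, Matrix.mul_one,
        ← Matrix.mul_assoc, hD, Matrix.one_mul]
    have hf : tracePreserving f := fun M => by
      change (D * M * Dᴴ).trace = M.trace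
      rw [hDH, trace_mul_comm, ← Matrix.mul_assoc, hD, Matrix.one_mul]
    have h : D * N * Dᴴ = N := hN (WideSubcategory.isoMk ⟨f, f, hff, hff⟩ hf hf)
    have h' := congrFun (congrFun h i) j
    rw [hDH, mul_diagonal, diagonal_mul, if_pos rfl, if_neg hij.symm] at h'
    linear_combination -h' / 2
  have hdiag (i j : H.ι) : N i i = N j j := by
    have h : relabel (Equiv.swap i j) N = N :=
      hN (WideSubcategory.isoMk (relabelIso (Equiv.swap i j)) (trace_relabel _).1
        (trace_relabel _).2)
    have h' := congrFun (congrFun h j) j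
    change N (Equiv.swap i j j) (Equiv.swap i j j) = N j j at h'
    rwa [Equiv.swap_apply_right] at h'
  change (N.trace / Fintype.card H.ι) • (1 : Op H) = N
  ext i j
  by_cases hij : i = j
  · subst hij
    have ht : N.trace = Fintype.card H.ι * N i i :=
      (Finset.sum_congr rfl fun k _ => hdiag k i).trans (by simp)
    rw [ht, mul_div_cancel_left₀ _ (Nat.cast_ne_zero.mpr Fintype.card_ne_zero)]
    simp
  · rw [hoff hij]
    simp [hij]

/-- The completely depolarising map on the outputs of all boxes. -/
noncomputable def depolariseOutputs : ∀ A : Boxes QSystem, A.wires ⟶ A.wires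
  | .box H => H ◁ depolariseProcess H
  | .tensor A B => depolariseOutputs A ⊗ₘ depolariseOutputs B

theorem deterministic_whiskerLeft_box {H : QSystem} {g : H ⟶ H} (hg : tracePreserving g) :
    processEnvironment.deterministic (X := .box H) (Y := .box H) (H ◁ g) := by
  refine deterministic_of_mapsTo ?_
  rintro _ ⟨f, hf, rfl⟩
  exact ⟨f ≫ g, tracePreserving.comp_mem _ _ hf hg, rfl⟩

/-- Local channels act on the outputs of boxes by deterministic processes, so an operator invariant
under all invertible deterministic processes is invariant under depolarisation of the outputs. -/
theorem depolariseOutputs_eq_self {A : Boxes QSystem} {M : Op A.wires}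
    (hM : ∀ T : (⟨A⟩ : QBox) ≅ ⟨A⟩, boxLin (A := A) (B := A) T.hom.hom M = M) :
    toLin (depolariseOutputs A) M = M := by
  induction A with
  | box H =>
    ext ⟨i, x⟩ ⟨j, y⟩
    refine congrFun (congrFun (depolarise_eq_self (N := Matrix.of fun x y => M (i, x) (j, y))
      fun T => ?_) x) y
    have h := hM ⟨⟨H ◁ T.hom.hom, deterministic_whiskerLeft_box T.hom.property⟩,
      ⟨H ◁ T.inv.hom, deterministic_whiskerLeft_box T.inv.property⟩,
      WideSubcategory.hom_ext _ ?_, WideSubcategory.hom_ext _ ?_⟩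
    · ext x y
      exact congrFun (congrFun h (i, x)) (j, y)
    · have e : T.hom.hom ≫ T.inv.hom = 𝟙 H :=
        congrArg (fun f : (⟨H⟩ : CPTP) ⟶ ⟨H⟩ => f.hom) T.hom_inv_id
      change H ◁ T.hom.hom ≫ H ◁ T.inv.hom = 𝟙 (H ⊗ H)
      rw [← whiskerLeft_comp, e, whiskerLeft_id]
    · have e : T.inv.hom ≫ T.hom.hom = 𝟙 H :=
        congrArg (fun f : (⟨H⟩ : CPTP) ⟶ ⟨H⟩ => f.hom) T.inv_hom_id
      change H ◁ T.inv.hom ≫ H ◁ T.hom.hom = 𝟙 (H ⊗ H)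
      rw [← whiskerLeft_comp, e, whiskerLeft_id]
  | tensor A B ihA ihB =>
    have h₁ : tensorRight (toLin (depolariseOutputs A)) B.wires.ι M = M := by
      ext ⟨i, x⟩ ⟨j, y⟩
      refine congrFun (congrFun (ihA (M := Matrix.of fun i j => M (i, x) (j, y)) fun T => ?_) i) j
      have h := hM (whiskerRightIso T ⟨B⟩)
      ext i j
      exact congrFun (congrFun h (i, x)) (j, y)
    have h₂ : tensorLeft A.wires.ι (toLin (depolariseOutputs B)) M = M := by
      ext ⟨i, x⟩ ⟨j, y⟩
      refine congrFun (congrFun (ihB (M := Matrix.of fun x y => M (i, x) (j, y)) fun T => ?_) x) y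
      have h := hM (whiskerLeftIso ⟨A⟩ T)
      ext x y
      exact congrFun (congrFun h (i, x)) (j, y)
    exact (congrArg (tensorLeft A.wires.ι (toLin (depolariseOutputs B))) h₁).trans h₂

theorem depolariseProcess_tensor (X Y : QSystem) :
    depolariseProcess (X ⊗ Y) = depolariseProcess X ⊗ₘ depolariseProcess Y := by
  refine hom_ext fun M => ?_
  ext ⟨a, c⟩ ⟨b, d⟩
  rw [toLin_tensorHom]
  change (M.trace / (Fintype.card (X.ι × Y.ι) : ℂ)) *
      (1 : Matrix (X.ι × Y.ι) (X.ι × Y.ι) ℂ) (a, c) (b, d) =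
    (∑ y, (∑ x, M (x, y) (x, y)) / (Fintype.card X.ι : ℂ) * (1 : Op X) a b) /
      (Fintype.card Y.ι : ℂ) * (1 : Op Y) c d
  have ht : M.trace = ∑ y, ∑ x, M (x, y) (x, y) :=
    Fintype.sum_prod_type_right fun p : X.ι × Y.ι => M p p
  rw [ht, ← one_kronecker_one, kroneckerMap_apply, ← Finset.sum_mul, ← Finset.sum_div,
    Fintype.card_prod, Nat.cast_mul]
  ring

theorem depolariseOutputs_comp_extr : ∀ A : Boxes QSystem,
    depolariseOutputs A ≫ extr A = extr A ≫ depolariseProcess (outs A)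
  | .box H => by
    change H ◁ depolariseProcess H ≫ normalisedTrace H ▷ H ≫ (λ_ H).hom =
      (normalisedTrace H ▷ H ≫ (λ_ H).hom) ≫ depolariseProcess H
    rw [whisker_exchange_assoc, Category.assoc, leftUnitor_naturality]
  | .tensor A B => by
    change (depolariseOutputs A ⊗ₘ depolariseOutputs B) ≫ (extr A ⊗ₘ extr B) =
      (extr A ⊗ₘ extr B) ≫ depolariseProcess (outs A ⊗ outs B)
    rw [depolariseProcess_tensor, tensorHom_comp_tensorHom, tensorHom_comp_tensorHom,
      depolariseOutputs_comp_extr, depolariseOutputs_comp_extr]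

theorem isMaximallyMixed_outState {A : QBox} (s : 𝟙_ QBox ⟶ A) (hs : IsMaximallyMixed s) :
    IsMaximallyMixed (outState s) := by
  have hinv : toLin (depolariseOutputs A.obj) (boxOp s) = boxOp s :=
    depolariseOutputs_eq_self fun T => congrArg (fun f : 𝟙_ QBox ⟶ A => boxOp f) (hs.2 T)
  have h : toLin (outState s).hom 1 =
      toLin (depolariseProcess (outs A.obj)) (toLin (outState s).hom 1) := by
    rw [toLin_outState]
    have e := congrArg (fun f => toLin f (boxOp s)) (depolariseOutputs_comp_extr A.obj)
    conv_lhs => rw [← hinv]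
    exact e
  refine isMaximallyMixed_of_toLin_eq _ (c := (Fintype.card (outs A.obj).ι : ℝ)⁻¹)
    (by positivity) (h.trans ?_)
  change ((toLin (outState s).hom 1).trace / (Fintype.card (outs A.obj).ι : ℂ)) •
    (1 : Op (outs A.obj)) = _
  rw [trace_state, one_div, ← Complex.ofReal_natCast, ← Complex.ofReal_inv]
  rfl

end MaximallyMixed

/-! ### Hyper-decoherence of boxes to channels -/

open Matrix in
/-- On a single qubit box, the operator `|0⟩⟨0| ⊗ |0⟩⟨0|` is not invariant. -/
theorem hypdec_box_bool_ne_id :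
    hypdec (.box ⟨Bool⟩) ≠ 𝟙 (Boxes.box (⟨Bool⟩ : QSystem)) := by
  intro h
  let M : Matrix (Bool × Bool) (Bool × Bool) ℂ := single (false, false) (false, false) 1
  have h' : depolarise Bool (Matrix.of fun i j => M (i, false) (j, false)) true true =
      M (true, false) (true, false) :=
    congrArg (fun f : Boxes.box (⟨Bool⟩ : QSystem) ⟶ .box ⟨Bool⟩ =>
      boxLin f M (true, false) (true, false)) h
  simp [M, depolarise, trace, single_apply] at h'

/-- The hyper-decoherence of the theory of quantum boxes to quantum theory. -/
noncomputable def boxHyperDecoherence : HyperDecoherence processEnvironment tracePreserving where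
  toIdempotentFamily := hypdecFamily
  noBackwardsSignalling A := noBackwardsSignalling_hypdec A.obj
  equiv := outputFunctor
  full := inferInstance
  faithful := inferInstance
  essSurj := inferInstance
  map_mixture f g k a b _ h := outputFunctor_map_mixture f g k a b h
  copreserves_pure s hs := isPure_of_isPure_outState s hs
  preserves_maximallyMixed s hs := isMaximallyMixed_outState s hs

end QuantumBox

theorem mainTheorem1 :
    ∃ h : QuantumBox.HyperDecoherence QuantumBox.processEnvironment QuantumBox.tracePreserving,
      (∀ A : QuantumBox.QBox, (h.map A).hom = QuantumBox.hypdec A.obj) ∧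
      (∃ A : QuantumBox.QBox, h.map A ≠ 𝟙 A) ∧
      (∀ A : QuantumBox.QBox, ∃ s : 𝟙_ QuantumBox.QBox ⟶ A, QuantumBox.IsMaximallyMixed s) := by
  refine ⟨QuantumBox.boxHyperDecoherence, fun _ => rfl, ⟨⟨.box ⟨Bool⟩⟩, fun h => ?_⟩,
    QuantumBox.exists_isMaximallyMixed⟩
  exact QuantumBox.hypdec_box_bool_ne_id
    (congrArg (fun f : (⟨.box ⟨Bool⟩⟩ : QuantumBox.QBox) ⟶ ⟨.box ⟨Bool⟩⟩ => f.hom) h)
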